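/- **Setting.** Let $M$ be a compact metrizable space. For maps $f_n$ of a topological space $X$ to itself and $x,y\in X$, write $f_n|_{X\smallsetminus\{y\}}\to x$ if $f_n$ converges locally uniformly on $X\smallsetminus\{y\}$ to the constant $x$. A group $\Gamma$ acting on a space $X$ by homeomorphisms acts as a *convergence group* if every sequence of distinct elements of $\Gamma$ has a subsequence $(\gamma_{n_j})$ with $\gamma_{n_j}|_{X\smallsetminus\{y\}}\to x$ for some $x,y\in X$. Let $\Gamma\subset\mathsf{Homeo}(M)$ be a subgroup acting as a convergence group on $M$. Its limit set $\Lambda(\Gamma)$ is the set of $x\in M$ for which there are $y\in M$ and a sequence $(\gamma_n)$ in $\Gamma$ with $\gamma_n|_{M\smallsetminus\{y\}}\to x$. Assume $\Gamma$ is *non-elementary*: $\Lambda(\Gamma)$ has at least three points. An element $\gamma\in\Gamma$ is *loxodromic* if it has two distinct fixed points $\gamma^+,\gamma^-\in\Lambda(\Gamma)$ such that $\gamma^{n}|_{M\smallsetminus\{\gamma^{-}\}}\to\gamma^{+}$ and $\gamma^{-n}|_{M\smallsetminus\{\gamma^{+}\}}\to\gamma^{-}$ as $n\to\infty$. Fix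 a *compatible metric* $\mathrm d$ on the set $\Gamma\sqcup M$, i.e. a metric whose topology is compact, induces on $\Gamma$ the discrete topology and on $M$ its given topology, and for which the natural action of $\Gamma$ on $\Gamma\sqcup M$ (left multiplication on $\Gamma$, the given action on $M$) is by homeomorphisms and is a convergence group action. A function $\sigma\colon\Gamma\times M\to\mathbb R$ is a *coarse-cocycle* if there is $\kappa$ such that $\limsup_{x\to x_0}|\sigma(\gamma,x_0)-\sigma(\gamma,x)|\le\kappa$ and $|\sigma(\gamma_1\gamma_2,x)-(\sigma(\gamma_1,\gamma_2x)+\sigma(\gamma_2,x))|\le\kappa$ for all $\gamma,\gamma_1,\gamma_2\in\Gamma$ and $x,x_0\in M$. It is *expanding* if * $\sigma(\gamma_n,\gamma_n^+)\to+\infty$ for every sequence of distinct loxodromic elements $\gamma_n\in\Gamma$ with $\liminf_n \mathrm d(\gamma_n^-,\gamma_n^+)>0$, and * there is a function $\gamma\mapsto\|\gamma\|_\sigma\in\mathbb R$ on $\Gamma$, called a $\sigma$-*magnitude*, such that for every $\epsilon>0$ there is $C>0$ with $\|\gamma\|_\sigma-C\le\sigma(\gamma,x)\le\|\gamma\|_\sigma+C$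 whenever $x\in M$, $\gamma\in\Gamma$ and $\mathrm d(x,\gamma^{-1})>\epsilon$. For a $\sigma$-magnitude put $Q_\sigma(s)=\sum_{\gamma\in\Gamma}e^{-s\|\gamma\|_\sigma}\in[0,+\infty]$ and $\delta_\sigma(\Gamma)=\inf\{s>0: Q_\sigma(s)<+\infty\}\in[0,+\infty]$. **Theorem.** Let $\sigma_0,\sigma_1\colon\Gamma\times M\to\mathbb R$ be expanding coarse-cocycles with $\delta_{\sigma_0}(\Gamma)=\delta_{\sigma_1}(\Gamma)=1$, let $0<\lambda<1$ and $\sigma_\lambda=\lambda\sigma_0+(1-\lambda)\sigma_1$. Then $\sigma_\lambda$ is an expanding coarse-cocycle and $$\delta_{\sigma_\lambda}(\Gamma)\le 1 .$$ Moreover, if $Q_{\sigma_\lambda}(\delta_{\sigma_\lambda}(\Gamma))=+\infty$, then the following are equivalent: 1. $\delta_{\sigma_\lambda}(\Gamma)=1$. 2. $\sup_{\gamma\in\Gamma}\bigl|\,\|\gamma\|_{\sigma_0}-\|\gamma\|_{\sigma_1}\bigr|<+\infty$. All of this holds for every choice of the magnitudes of $\sigma_0$, $\sigma_1$ and $\sigma_\lambda$.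 -/

import Mathlib

open Filter Topology
open scoped ENNReal NNReal

namespace CoarsePS

/-- The maps `f n`, restricted to the complement of `y`, converge locally uniformly to the constant
map with value `x`. Uniform closeness to a constant only involves the neighbourhoods of that
constant, so this makes sense in a topological space; see
`convergesAwayFrom_iff_tendstoLocallyUniformlyOn`. -/
def ConvergesAwayFrom {X : Type*} [TopologicalSpace X] (f : ℕ → X → X) (x y : X) : Prop :=
  ∀ U ∈ 𝓝 x, ∀ z, z ≠ y → ∃ V ∈ 𝓝[{y}ᶜ] z, ∀ᶠ n in atTop, ∀ w ∈ V, f n w ∈ U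

theorem convergesAwayFrom_iff_tendstoLocallyUniformlyOn {X : Type*} [UniformSpace X]
    (f : ℕ → X → X) (x y : X) :
    ConvergesAwayFrom f x y ↔ TendstoLocallyUniformlyOn f (fun _ => x) atTop {y}ᶜ := by
  constructor
  · intro h u hu z hz
    exact h _ (mem_nhds_left x hu) z hz
  · intro h U hU z hz
    obtain ⟨u, hu, hsub⟩ := UniformSpace.mem_nhds_iff.1 hU
    obtain ⟨V, hV, hn⟩ := h u hu z hz
    exact ⟨V, hV, hn.mono fun n hn w hw => hsub (hn w hw)⟩

/-- The family of maps `act γ` of `X` is a (discrete) convergence action: each map is continuous,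
and every sequence of distinct elements has a subsequence which converges locally uniformly to a
point `x` off a point `y`. (It is only used for actions of a group `G`, so that
every `act γ` is then a homeomorphism.) -/
def IsConvergenceAction {G X : Type*} [TopologicalSpace X] (act : G → X → X) : Prop :=
  (∀ γ, Continuous (act γ)) ∧
  ∀ g : ℕ → G, Function.Injective g →
    ∃ (x y : X) (φ : ℕ → ℕ), StrictMono φ ∧ ConvergesAwayFrom (fun j => act (g (φ j))) x y

section

variable {M : Type*} [TopologicalSpace M]

/-- `Γ ⊂ Homeo(M)` is a convergence group. -/
def IsConvergenceGroup (Γ : Subgroup (M ≃ₜ M)) : Prop :=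
  IsConvergenceAction (fun (γ : Γ) (x : M) => (γ : M ≃ₜ M) x)

/-- The limit set `Λ(Γ)`. -/
def limitSet (Γ : Subgroup (M ≃ₜ M)) : Set M :=
  {x | ∃ (y : M) (g : ℕ → Γ), ConvergesAwayFrom (fun n z => (g n : M ≃ₜ M) z) x y}

/-- `Γ` is non-elementary: its limit set contains at least three points. -/
def IsNonelementary (Γ : Subgroup (M ≃ₜ M)) : Prop :=
  3 ≤ (limitSet Γ).encard

/-- `γ` is loxodromic with attracting fixed point `p` and repelling fixed point `m`. -/
structure IsLoxodromic (Γ : Subgroup (M ≃ₜ M)) (γ : Γ) (p m : M) : Prop where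
  ne : p ≠ m
  attracting_mem : p ∈ limitSet Γ
  repelling_mem : m ∈ limitSet Γ
  attracting_fixed : (γ : M ≃ₜ M) p = p
  repelling_fixed : (γ : M ≃ₜ M) m = m
  forward : ConvergesAwayFrom (fun n z => ((γ ^ n : Γ) : M ≃ₜ M) z) p m
  backward : ConvergesAwayFrom (fun n z => (((γ⁻¹) ^ n : Γ) : M ≃ₜ M) z) m p

/-- The set `Γ ⊔ M`. It is a separate type, so that it does not carry the topology of a disjoint
union. -/
def GroupUnion (Γ : Subgroup (M ≃ₜ M)) : Type _ := Γ ⊕ M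

namespace GroupUnion

/-- The inclusion of `Γ` in `Γ ⊔ M`. -/
def ofGroup (Γ : Subgroup (M ≃ₜ M)) (γ : Γ) : GroupUnion Γ := Sum.inl γ

/-- The inclusion of `M` in `Γ ⊔ M`. -/
def ofPoint (Γ : Subgroup (M ≃ₜ M)) (x : M) : GroupUnion Γ := Sum.inr x

/-- The natural action of `Γ` on `Γ ⊔ M`: left multiplication on `Γ`, the given action on `M`. -/
def act (Γ : Subgroup (M ≃ₜ M)) (γ : Γ) : GroupUnion Γ → GroupUnion Γ :=
  Sum.map (fun g : Γ => γ * g) (fun x : M => (γ : M ≃ₜ M) x)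

end GroupUnion

/-- The given metric on `Γ ⊔ M` is compatible: it induces a compactifying topology. -/
structure IsCompatibleMetric (Γ : Subgroup (M ≃ₜ M)) [MetricSpace (GroupUnion Γ)] : Prop where
  compact : CompactSpace (GroupUnion Γ)
  isEmbedding_ofPoint : IsEmbedding (GroupUnion.ofPoint Γ)
  /-- The inclusion of `Γ` is an embedding for the discrete topology `⊥` on `Γ`. -/
  isEmbedding_ofGroup : @IsEmbedding Γ (GroupUnion Γ) ⊥ _ (GroupUnion.ofGroup Γ)
  convergence : IsConvergenceAction (GroupUnion.act Γ)

/-- `σ` is a `κ`-coarse-cocycle. The first field says that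
`limsup_{x → x₀} |σ(γ, x₀) - σ(γ, x)| ≤ κ`. -/
structure IsKappaCoarseCocycle (Γ : Subgroup (M ≃ₜ M)) (κ : ℝ) (σ : Γ → M → ℝ) : Prop where
  coarselyContinuous : ∀ (γ : Γ) (x₀ : M), ∀ ε > 0, ∀ᶠ x in 𝓝 x₀, |σ γ x₀ - σ γ x| ≤ κ + ε
  coarseCocycle : ∀ (γ₁ γ₂ : Γ) (x : M),
    |σ (γ₁ * γ₂) x - (σ γ₁ ((γ₂ : M ≃ₜ M) x) + σ γ₂ x)| ≤ κ

/-- `σ` is a coarse-cocycle. -/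
def IsCoarseCocycle (Γ : Subgroup (M ≃ₜ M)) (σ : Γ → M → ℝ) : Prop :=
  ∃ κ : ℝ, IsKappaCoarseCocycle Γ κ σ

/-- `σ` is proper: `σ(γₙ, γₙ⁺) → +∞` for every sequence of distinct loxodromic elements with
`liminf dist(γₙ⁻, γₙ⁺) > 0`. -/
def IsProperCocycle (Γ : Subgroup (M ≃ₜ M)) [MetricSpace (GroupUnion Γ)] (σ : Γ → M → ℝ) : Prop :=
  ∀ (g : ℕ → Γ) (p m : ℕ → M), Function.Injective g →
    (∀ n, IsLoxodromic Γ (g n) (p n) (m n)) →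
    (∃ c > 0, ∀ᶠ n in atTop, c ≤ dist (GroupUnion.ofPoint Γ (m n)) (GroupUnion.ofPoint Γ (p n))) →
    Tendsto (fun n => σ (g n) (p n)) atTop atTop

/-- `N` is a choice of `σ`-magnitude `γ ↦ ‖γ‖_σ`. -/
def IsMagnitude (Γ : Subgroup (M ≃ₜ M)) [MetricSpace (GroupUnion Γ)] (σ : Γ → M → ℝ)
    (N : Γ → ℝ) : Prop :=
  ∀ ε > 0, ∃ C > 0, ∀ (x : M) (γ : Γ),
    ε < dist (GroupUnion.ofPoint Γ x) (GroupUnion.ofGroup Γ γ⁻¹) →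
      N γ - C ≤ σ γ x ∧ σ γ x ≤ N γ + C

/-- `σ` is an expanding coarse-cocycle. -/
structure IsExpanding (Γ : Subgroup (M ≃ₜ M)) [MetricSpace (GroupUnion Γ)]
    (σ : Γ → M → ℝ) : Prop where
  isCoarseCocycle : IsCoarseCocycle Γ σ
  proper : IsProperCocycle Γ σ
  exists_magnitude : ∃ N : Γ → ℝ, IsMagnitude Γ σ N

end

/-- The Poincaré series `∑_γ exp(-s ‖γ‖) ∈ [0, ∞]` of a magnitude function. -/
noncomputable def poincareSeries {G : Type*} (N : G → ℝ) (s : ℝ) : ℝ≥0∞ :=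
  ∑' γ : G, ENNReal.ofReal (Real.exp (-s * N γ))

/-- The critical exponent `inf {s > 0 : Q(s) < ∞} ∈ [0, ∞]` of a magnitude function. -/
noncomputable def criticalExponent {G : Type*} (N : G → ℝ) : ℝ≥0∞ :=
  sInf {t : ℝ≥0∞ | ∃ s : ℝ, 0 < s ∧ poincareSeries N s < ∞ ∧ t = ENNReal.ofReal s}

end CoarsePS

open CoarsePS

namespace CoarsePS

/-! The inequality is convexity of the exponential: each term of the Poincaré series of λN₀ +
(1-λ)N₁ is at most the sum of the terms for N₀ and N₁, and every magnitude of the combined cocycle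
is at bounded distance from this combination. Likewise a bounded N₀ - N₁ makes the exponents agree.
The substance is that divergence at 1 forces N₀ - N₁ to be bounded.

Two coarse facts carry the argument. On Γ ⊔ M all but finitely many h map the complement of a ball
about h⁻¹ close to h, and no point is fixed by the whole group (`IsContracting`). Magnitudes are
additive up to a constant on products without cancellation (`IsCoarselyAdditive`). Weak limits of
orbit measures as s decreases to 1 then give μ, μ₀, μ₁ for which the shadow of γ has mass comparable
to exp(-N γ), for N = λN₀ + (1-λ)N₁, N₀ and N₁ respectively (`IsContracting.exists_shadowMeasure`);
conformality is never needed. Meeting shadows are nested after enlargement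
(`IsContracting.shadow_nested`), so a Vitali lemma holds.

Let B t be the union of the shadows of those γ with |N₀ γ - N₁ γ| > t. For such γ, N exceeds N₀ or
N₁ by a fixed multiple of t, and comparison with μ₀ and μ₁ on disjoint shadows gives μ (B t) → 0.
Divergence of the series gives positive μ-measure to the conical points, by a second moment
estimate. If N₀ - N₁ were unbounded, right multiplication by one of finitely many elements would
create a large discrepancy next to any γ; then B t would occupy a definite proportion of every
shadow, hence contain almost every conical point, for every t. This is a contradiction. -/

theorem exists_forall_neg_le_of_tendsto {G : Type*} {N : G → ℝ} (h : Tendsto N cofinite atTop) :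
    ∃ K, ∀ g, -K ≤ N g := by
  have hfin : {g | N g < 0}.Finite := by
    simpa [Filter.Eventually, mem_cofinite, Set.compl_def] using h.eventually_ge_atTop 0
  obtain ⟨K, hK⟩ := (hfin.image N).bddBelow
  refine ⟨max (-K) 0, fun g => ?_⟩
  rcases lt_or_ge (N g) 0 with h | h
  · linarith [hK ⟨g, h, rfl⟩, le_max_left (-K) 0]
  · linarith [le_max_right (-K) 0]

/-! ### Contracting actions and the geometry of shadows. -/

section Contracting

variable {G X : Type*} [Group G] [MetricSpace X] {o : G → X} {N : G → ℝ} {r : ℝ}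

/-- A function `N` on `G` which tends to infinity, and is additive up to bounded error on pairs
`a`, `h` for which `o h` and `o a⁻¹` are not close. -/
structure IsCoarselyAdditive (o : G → X) (N : G → ℝ) : Prop where
  tendsto : Tendsto N cofinite atTop
  additive : ∀ ε > 0, ∃ C, ∀ a h : G, ε ≤ dist (o h) (o a⁻¹) → |N (a * h) - N a - N h| ≤ C
  mul_left : ∀ f : G, ∃ C, ∀ g : G, |N (f * g) - N g| ≤ C

theorem IsCoarselyAdditive.finite_le (hN : IsCoarselyAdditive o N) (K : ℝ) :
    {g | N g ≤ K}.Finite := by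
  have := hN.tendsto.eventually_gt_atTop K
  simpa [Filter.Eventually, mem_cofinite, Set.compl_def] using this

variable [MulAction G X]

/-- A group `G` acts by homeomorphisms on `X`, which contains the image of `G` under an equivariant
map `o`. All but finitely many elements `h` contract the complement of a given ball about `o h⁻¹`
into a given ball about `o h`, and there is no global fixed point. -/
structure IsContracting (o : G → X) : Prop where
  continuous_smul : ∀ g : G, Continuous fun x : X => g • x
  map_mul : ∀ g h : G, o (g * h) = g • o h
  contracting : ∀ ε > 0, ∀ η > 0, ∀ᶠ h : G in cofinite, ∀ x : X,
    ε ≤ dist x (o h⁻¹) → dist (h • x) (o h) ≤ η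
  exists_smul_ne : ∀ x : X, ∃ g : G, g • x ≠ x

/-- The shadow of `γ`: the image under `γ` of the complement of a ball about `o γ⁻¹`. -/
def shadow (o : G → X) (r : ℝ) (γ : G) : Set X :=
  {x | r ≤ dist (γ⁻¹ • x) (o γ⁻¹)}

theorem shadow_anti {r' : ℝ} (h : r' ≤ r) (γ : G) : shadow o r γ ⊆ shadow o r' γ :=
  fun _ hx => h.trans hx

theorem IsContracting.isClosed_shadow (ho : IsContracting o) (r : ℝ) (γ : G) :
    IsClosed (shadow o r γ) :=
  isClosed_le continuous_const ((ho.continuous_smul γ⁻¹).dist continuous_const)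

theorem IsContracting.shadow_near (ho : IsContracting o) (hr : 0 < r) {η : ℝ} (hη : 0 < η) :
    ∀ᶠ γ : G in cofinite, ∀ x ∈ shadow o r γ, dist x (o γ) ≤ η := by
  filter_upwards [ho.contracting r hr η hη] with γ hγ x hx
  simpa using hγ (γ⁻¹ • x) hx

variable [CompactSpace X]

theorem IsContracting.uniformContinuous_smul (ho : IsContracting o) (g : G) :
    UniformContinuous fun x : X => g • x :=
  CompactSpace.uniformContinuous_of_continuous (ho.continuous_smul g)

/-- For finitely many group elements there is a common modulus of continuity. -/
theorem IsContracting.exists_modulus (ho : IsContracting o) {S : Set G} (hS : S.Finite)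
    {ε : ℝ} (hε : 0 < ε) :
    ∃ δ > 0, ∀ g ∈ S, ∀ x y : X, dist x y < δ → dist (g • x) (g • y) < ε := by
  induction S, hS using Set.Finite.induction_on with
  | empty => exact ⟨1, one_pos, by simp⟩
  | @insert a s _ _ ih =>
    obtain ⟨δ, hδ, h⟩ := ih
    obtain ⟨δ', hδ', h'⟩ := Metric.uniformContinuous_iff.1 (ho.uniformContinuous_smul a) ε hε
    refine ⟨min δ δ', lt_min hδ hδ', fun g hg x y hxy => ?_⟩
    rcases hg with rfl | hg
    · exact h' (hxy.trans_le (min_le_right _ _))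
    · exact h g hg x y (hxy.trans_le (min_le_left _ _))

/-- An element moving a point also moves its neighbours, so by compactness finitely many elements
displace every point by a uniform amount. The factor 2 leaves room to replace the point by a nearby
one. -/
theorem IsContracting.exists_displacement (ho : IsContracting o) :
    ∃ S : Finset G, ∃ ρ > 0, ∀ x : X, ∃ f ∈ S, 2 * ρ ≤ dist (f • x) x := by
  classical
  choose f hf using ho.exists_smul_ne
  have hpos : ∀ x : X, 0 < dist (f x • x) x := fun x => dist_pos.2 (hf x)
  obtain ⟨t, ht⟩ := isCompact_univ.elim_nhds_subcover
    (fun x => {z : X | dist (f x • x) x / 2 < dist (f x • z) z}) (fun x _ => by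
      refine (isOpen_lt continuous_const
        ((ho.continuous_smul (f x)).dist continuous_id)).mem_nhds ?_
      change _ < dist (f x • x) x
      linarith [hpos x])
  have hρ : ∃ ρ > 0, ∀ x ∈ t, ρ ≤ dist (f x • x) x := by
    clear ht
    induction t using Finset.induction_on with
    | empty => exact ⟨1, one_pos, by simp⟩
    | insert a s _ ih =>
      obtain ⟨ρ, hρ, h⟩ := ih
      refine ⟨min ρ (dist (f a • a) a), lt_min hρ (hpos a), fun x hx => ?_⟩
      rcases Finset.mem_insert.1 hx with rfl | hx
      · exact min_le_right _ _
      · exact (min_le_left _ _).trans (h x hx)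
  obtain ⟨ρ, hρ, h⟩ := hρ
  refine ⟨t.image f, ρ / 4, by positivity, fun x => ?_⟩
  obtain ⟨y, hy, hxy⟩ := Set.mem_iUnion₂.1 (ht.2 (Set.mem_univ x))
  refine ⟨f y, Finset.mem_image_of_mem f hy, ?_⟩
  have h1 := h y hy
  have h2 : dist (f y • y) y / 2 < dist (f y • x) x := hxy
  linarith

/-- If two shadows meet, then that of the larger element is contained in an enlargement of the other
one. -/
theorem IsContracting.shadow_nested (ho : IsContracting o) (hN : IsCoarselyAdditive o N)
    (hr : 0 < r) (D : ℝ) :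
    ∃ r' > 0, ∃ C, ∀ α β : G, (shadow o r α ∩ shadow o r β).Nonempty → N α ≤ N β + D →
      shadow o r β ⊆ shadow o r' α ∧ N α + N (α⁻¹ * β) ≤ N β + C := by
  obtain ⟨C₁, hC₁⟩ := hN.additive (r / 2) (by positivity)
  have hS₁ : {h : G | N h⁻¹ ≤ D + C₁}.Finite :=
    (hN.finite_le (D + C₁)).preimage inv_injective.injOn
  have hS₂ := Filter.eventually_cofinite.1
    (ho.contracting (r / 2) (by positivity) (r / 4) (by positivity))
  -- Write β = α h. Outside the finite set S, h contracts and N h⁻¹ is large; on S, uniform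
  -- continuity of the finitely many h⁻¹ suffices.
  set S : Set G := {h : G | N h⁻¹ ≤ D + C₁} ∪ {h : G | ¬ ∀ x : X,
    r / 2 ≤ dist x (o h⁻¹) → dist (h • x) (o h) ≤ r / 4} with hSdef
  have hS : S.Finite := hS₁.union hS₂
  obtain ⟨δ, hδ, hmod⟩ := ho.exists_modulus (hS.image (·⁻¹)) hr
  obtain ⟨K, hK⟩ := (hS.image N).bddAbove
  refine ⟨min δ (r / 2), lt_min hδ (by positivity), max C₁ (D + K), ?_⟩
  rintro α β ⟨x, hxα, hxβ⟩ hαβ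
  set h : G := α⁻¹ * β with hh
  have hhβ : h⁻¹ * α⁻¹ = β⁻¹ := by rw [hh]; group
  by_cases hmem : h ∈ S
  · constructor
    · intro w hw
      by_contra hlt
      have hlt : dist (α⁻¹ • w) (o α⁻¹) < δ := by
        have : ¬ min δ (r / 2) ≤ dist (α⁻¹ • w) (o α⁻¹) := hlt
        exact (not_le.1 this).trans_le (min_le_left _ _)
      have := hmod h⁻¹ ⟨h, hmem, rfl⟩ _ _ hlt
      rw [← ho.map_mul, ← mul_smul, hhβ] at this
      exact absurd hw (not_le.2 this)
    · have := hK ⟨h, hmem, rfl⟩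
      linarith [le_max_right C₁ (D + K)]
  · have hn1 : D + C₁ < N h⁻¹ := by
      by_contra hc
      exact hmem (Or.inl (not_lt.1 hc))
    have hn2 : ∀ x : X, r / 2 ≤ dist x (o h⁻¹) → dist (h • x) (o h) ≤ r / 4 := by
      by_contra hc
      exact hmem (Or.inr hc)
    -- Otherwise α = β h⁻¹ would be a product without cancellation, making N α larger than N β + D.
    have hclose : dist (o h⁻¹) (o β⁻¹) < r / 2 := by
      by_contra hc
      have := (abs_le.1 (hC₁ β h⁻¹ (not_lt.1 hc))).1
      have hα : β * h⁻¹ = α := by rw [hh]; group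
      rw [hα] at this
      linarith
    have key : ∀ w ∈ shadow o r β, dist (α⁻¹ • w) (o h) ≤ r / 4 := by
      intro w hw
      have hw : r ≤ dist (β⁻¹ • w) (o β⁻¹) := hw
      have h1 : r / 2 ≤ dist (β⁻¹ • w) (o h⁻¹) := by
        linarith [dist_triangle (β⁻¹ • w) (o h⁻¹) (o β⁻¹)]
      have h2 := hn2 _ h1
      rwa [← mul_smul, hh, mul_assoc, mul_inv_cancel, mul_one] at h2
    have hx : r ≤ dist (α⁻¹ • x) (o α⁻¹) := hxα
    -- The common point x, pulled back by α, is near o h but far from o α⁻¹. Hence β = α h has no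
    -- cancellation, and the whole pulled-back shadow of β, being near o h, avoids o α⁻¹.
    have hfar : r * (3 / 4) ≤ dist (o h) (o α⁻¹) := by
      linarith [key x hxβ, dist_triangle (α⁻¹ • x) (o h) (o α⁻¹)]
    constructor
    · intro w hw
      have : dist (o h) (o α⁻¹) ≤ dist (α⁻¹ • w) (o h) + dist (α⁻¹ • w) (o α⁻¹) := by
        rw [dist_comm (α⁻¹ • w) (o h)]; exact dist_triangle _ _ _
      have h2 : min δ (r / 2) ≤ r / 2 := min_le_right _ _
      change min δ (r / 2) ≤ dist (α⁻¹ • w) (o α⁻¹)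
      linarith [key w hw]
    · have := (abs_le.1 (hC₁ α h (by linarith))).1
      have hβ : α * h = β := by rw [hh]; group
      rw [hβ] at this
      linarith [le_max_left C₁ (D + K)]

end Contracting

/-- The exponential function with values in `[0, ∞]`. -/
noncomputable def expENN (x : ℝ) : ℝ≥0∞ := ENNReal.ofReal (Real.exp x)

theorem expENN_add (x y : ℝ) : expENN (x + y) = expENN x * expENN y := by
  rw [expENN, Real.exp_add, ENNReal.ofReal_mul (Real.exp_pos x).le]; rfl

theorem expENN_mono {x y : ℝ} (h : x ≤ y) : expENN x ≤ expENN y :=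
  ENNReal.ofReal_le_ofReal (Real.exp_le_exp.2 h)

theorem expENN_ne_top (x : ℝ) : expENN x ≠ ∞ := ENNReal.ofReal_ne_top

theorem expENN_ne_zero (x : ℝ) : expENN x ≠ 0 := by simp [expENN, Real.exp_pos]

theorem continuous_expENN : Continuous expENN :=
  ENNReal.continuous_ofReal.comp Real.continuous_exp

theorem expENN_le_mul {x y c : ℝ} (h : x ≤ c + y) : expENN x ≤ expENN c * expENN y :=
  expENN_add c y ▸ expENN_mono h

theorem poincareSeries_eq {G : Type*} (N : G → ℝ) (s : ℝ) :
    poincareSeries N s = ∑' g, expENN (-s * N g) := rfl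

theorem poincareSeries_ne_zero {G : Type*} [Nonempty G] {N : G → ℝ} (s : ℝ) : poincareSeries N s ≠ 0 := by
  rw [poincareSeries_eq]
  intro h
  exact expENN_ne_zero _ (ENNReal.tsum_eq_zero.1 h (Classical.arbitrary G))

/-! ### Orbit measures weighted by the Poincaré series. -/

section OrbitMeasure

open MeasureTheory

variable {G X : Type*} [MeasurableSpace X] {o : G → X} {N : G → ℝ}

/-- The normalized sum of the Dirac masses at the points of the orbit of `G`, weighted by the terms
of the Poincaré series. -/
noncomputable def orbitMeasure (o : G → X) (N : G → ℝ) (s : ℝ) : Measure X :=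
  (poincareSeries N s)⁻¹ • Measure.sum fun g => expENN (-s * N g) • Measure.dirac (o g)

theorem orbitMeasure_apply (s : ℝ) {A : Set X} (hA : MeasurableSet A) :
    orbitMeasure o N s A =
      (poincareSeries N s)⁻¹ * ∑' g, (o ⁻¹' A).indicator (fun g => expENN (-s * N g)) g := by
  rw [orbitMeasure, Measure.smul_apply, Measure.sum_apply _ hA, smul_eq_mul]
  congr 1
  refine tsum_congr fun g => ?_
  rw [Measure.smul_apply, Measure.dirac_apply' _ hA, smul_eq_mul]
  by_cases h : o g ∈ A
  · simp [h]
  · simp [h]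

theorem isProbabilityMeasure_orbitMeasure [Nonempty G] {s : ℝ} (h : poincareSeries N s ≠ ∞) :
    IsProbabilityMeasure (orbitMeasure o N s) := by
  constructor
  rw [orbitMeasure_apply s MeasurableSet.univ, Set.preimage_univ, Set.indicator_univ,
    ← poincareSeries_eq, ENNReal.inv_mul_cancel (poincareSeries_ne_zero s) h]

end OrbitMeasure

/-! ### The shadow lemma and its passage to weak limits. -/

section Measure

open MeasureTheory

variable {G X : Type*} [Group G] [MetricSpace X] [MulAction G X] {o : G → X} {N : G → ℝ}

/-- Substituting g = γ h turns the orbit points in the shadow into exactly those h for which γ h has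
no cancellation, where additivity applies. -/
theorem IsContracting.orbitMeasure_shadow [MeasurableSpace X] [BorelSpace X]
    (ho : IsContracting o) (r s : ℝ) (γ : G) :
    orbitMeasure o N s (shadow o r γ) = (poincareSeries N s)⁻¹ *
      ∑' h, {h | r ≤ dist (o h) (o γ⁻¹)}.indicator (fun h => expENN (-s * N (γ * h))) h := by
  rw [orbitMeasure_apply s (ho.isClosed_shadow r γ).measurableSet]
  congr 1
  rw [← (Equiv.mulLeft γ).tsum_eq]
  refine tsum_congr fun h => ?_
  have : γ * h ∈ o ⁻¹' shadow o r γ ↔ h ∈ {h | r ≤ dist (o h) (o γ⁻¹)} := by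
    change r ≤ dist (γ⁻¹ • o (γ * h)) (o γ⁻¹) ↔ r ≤ dist (o h) (o γ⁻¹)
    rw [← ho.map_mul, inv_mul_cancel_left]
  by_cases hh : h ∈ {h | r ≤ dist (o h) (o γ⁻¹)}
  · rw [Equiv.coe_mulLeft, Set.indicator_of_mem (this.2 hh), Set.indicator_of_mem hh]
  · rw [Equiv.coe_mulLeft, Set.indicator_of_notMem (fun h' => hh (this.1 h')),
      Set.indicator_of_notMem hh]

/-- Additivity splits off the factor exp(-s N γ), and the remaining sum is at most the full series.
The bound s ≤ 2 makes the constant independent of s. -/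
theorem IsContracting.orbitMeasure_shadow_le [MeasurableSpace X] [BorelSpace X]
    (ho : IsContracting o) (hN : IsCoarselyAdditive o N) {r : ℝ} (hr : 0 < r) :
    ∃ K : ℝ≥0∞, K ≠ ∞ ∧ ∀ s, 0 ≤ s → s ≤ 2 → poincareSeries N s ≠ ∞ → ∀ γ,
      orbitMeasure o N s (shadow o r γ) ≤ K * expENN (-s * N γ) := by
  obtain ⟨C, hC⟩ := hN.additive r hr
  refine ⟨expENN (2 * max C 0), expENN_ne_top _, fun s hs hs2 hfin γ => ?_⟩
  rw [ho.orbitMeasure_shadow]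
  have hpt : ∀ h, {h | r ≤ dist (o h) (o γ⁻¹)}.indicator (fun h => expENN (-s * N (γ * h))) h ≤
      expENN (2 * max C 0) * expENN (-s * N γ) * expENN (-s * N h) := by
    intro h
    by_cases hh : h ∈ {h | r ≤ dist (o h) (o γ⁻¹)}
    · rw [Set.indicator_of_mem hh, mul_assoc, ← expENN_add]
      refine expENN_le_mul ?_
      have := (abs_le.1 (hC γ h hh)).1
      nlinarith [le_max_left C 0, le_max_right C 0]
    · simp [hh]
  calc _ ≤ (poincareSeries N s)⁻¹ *
        ∑' h, expENN (2 * max C 0) * expENN (-s * N γ) * expENN (-s * N h) := by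
        gcongr with h; exact hpt h
    _ = expENN (2 * max C 0) * expENN (-s * N γ) *
        ((poincareSeries N s)⁻¹ * poincareSeries N s) := by
        rw [ENNReal.tsum_mul_left, ← poincareSeries_eq]; ring
    _ = _ := by rw [ENNReal.inv_mul_cancel (poincareSeries_ne_zero s) hfin, mul_one]

variable [CompactSpace X]

/-- The terms of the Poincaré series do not concentrate near a point. -/
theorem IsContracting.nonconcentration (ho : IsContracting o) (hN : IsCoarselyAdditive o N) :
    ∃ r₀ > 0, ∃ K : ℝ≥0∞, K ≠ ∞ ∧ ∀ s, 0 ≤ s → s ≤ 2 → ∀ b : X,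
      poincareSeries N s ≤
        K * ∑' g, {g | r₀ ≤ dist (o g) b}.indicator (fun g => expENN (-s * N g)) g := by
  obtain ⟨S, ρ, hρ, hS⟩ := ho.exists_displacement
  obtain ⟨δ, hδ, hmod⟩ := ho.exists_modulus S.finite_toSet hρ
  choose C hC using hN.mul_left
  obtain ⟨C', hC'⟩ := (S.finite_toSet.image C).bddAbove
  refine ⟨min δ ρ, lt_min hδ hρ, 1 + expENN (2 * max C' 0),
    ENNReal.add_ne_top.2 ⟨ENNReal.one_ne_top, expENN_ne_top _⟩, fun s hs hs2 b => ?_⟩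
  obtain ⟨f, hf, hfb⟩ := hS b
  set A := {g | min δ ρ ≤ dist (o g) b} with hA
  set w : G → ℝ≥0∞ := fun g => expENN (-s * N g) with hw
  -- Since f moves b by at least 2ρ, it carries orbit points near b to orbit points away from b, and
  -- left multiplication by f changes the weights by a bounded factor.
  have hpt : ∀ g, Aᶜ.indicator w g ≤ expENN (2 * max C' 0) * A.indicator w (f * g) := by
    intro g
    by_cases hg : g ∈ A
    · simp [hg]
    · have hg' : dist (o g) b < min δ ρ := not_le.1 hg
      have h1 := hmod f hf _ _ (hg'.trans_le (min_le_left _ _))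
      have h2 : f * g ∈ A := by
        change min δ ρ ≤ dist (o (f * g)) b
        rw [ho.map_mul]
        have := dist_triangle (f • b) (f • o g) b
        rw [dist_comm (f • b) (f • o g)] at this
        linarith [min_le_right δ ρ]
      rw [Set.indicator_of_mem (show g ∈ Aᶜ from hg), Set.indicator_of_mem h2]
      refine expENN_le_mul ?_
      have h3 := (abs_le.1 (hC f g)).2
      have h4 : C f ≤ C' := hC' ⟨f, hf, rfl⟩
      nlinarith [le_max_left C' 0, le_max_right C' 0]
  calc poincareSeries N s = ∑' g, (A.indicator w g + Aᶜ.indicator w g) := by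
        rw [poincareSeries_eq]
        exact tsum_congr fun g => (congrFun (Set.indicator_self_add_compl A w) g).symm
    _ ≤ ∑' g, A.indicator w g + ∑' g, expENN (2 * max C' 0) * A.indicator w (f * g) := by
        rw [ENNReal.tsum_add]
        gcongr with g
        exact hpt g
    _ = _ := by
        have := (Equiv.mulLeft f).tsum_eq (A.indicator w)
        simp only [Equiv.coe_mulLeft] at this
        rw [ENNReal.tsum_mul_left, this, add_mul, one_mul]

variable [MeasurableSpace X] [BorelSpace X]

/-- The measure of the shadow of `γ` is comparable with `exp (-N γ)`. -/
structure IsShadowMeasure (o : G → X) (N : G → ℝ) (μ : Measure X) : Prop where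
  isProbabilityMeasure : IsProbabilityMeasure μ
  upper : ∀ r > 0, ∃ K : ℝ≥0∞, K ≠ ∞ ∧ ∀ γ, μ (shadow o r γ) ≤ K * expENN (-N γ)
  lower : ∃ r₀ > 0, ∃ K : ℝ≥0∞, K ≠ ∞ ∧ ∀ r ≤ r₀, ∀ γ, expENN (-N γ) ≤ K * μ (shadow o r γ)

/-- Nonconcentration at the point o γ⁻¹ leaves a definite fraction of the series on the elements h
for which additivity splits N (γ h). -/
theorem IsContracting.le_orbitMeasure_shadow (ho : IsContracting o)
    (hN : IsCoarselyAdditive o N) :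
    ∃ r > 0, ∃ K : ℝ≥0∞, K ≠ ∞ ∧ ∀ s, 0 ≤ s → s ≤ 2 → poincareSeries N s ≠ ∞ → ∀ γ,
      expENN (-s * N γ) ≤ K * orbitMeasure o N s (shadow o r γ) := by
  obtain ⟨r, hr, K, hK, hnc⟩ := ho.nonconcentration hN
  obtain ⟨C, hC⟩ := hN.additive r hr
  refine ⟨r, hr, K * expENN (2 * max C 0), ENNReal.mul_ne_top hK (expENN_ne_top _),
    fun s hs hs2 hfin γ => ?_⟩
  rw [ho.orbitMeasure_shadow]
  set A := {h | r ≤ dist (o h) (o γ⁻¹)}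
  have hpt : ∀ h, expENN (-s * N γ) * A.indicator (fun h => expENN (-s * N h)) h ≤
      expENN (2 * max C 0) * A.indicator (fun h => expENN (-s * N (γ * h))) h := by
    intro h
    by_cases hh : h ∈ A
    · rw [Set.indicator_of_mem hh, Set.indicator_of_mem hh, ← expENN_add]
      refine expENN_le_mul ?_
      have := (abs_le.1 (hC γ h hh)).2
      nlinarith [le_max_left C 0, le_max_right C 0]
    · simp [hh]
  calc expENN (-s * N γ) = (poincareSeries N s)⁻¹ * (expENN (-s * N γ) * poincareSeries N s) := by
        rw [mul_left_comm, ENNReal.inv_mul_cancel (poincareSeries_ne_zero s) hfin, mul_one]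
    _ ≤ (poincareSeries N s)⁻¹ * (expENN (-s * N γ) *
        (K * ∑' g, A.indicator (fun g => expENN (-s * N g)) g)) := by
        gcongr; exact hnc s hs hs2 _
    _ = (poincareSeries N s)⁻¹ *
        (K * ∑' g, expENN (-s * N γ) * A.indicator (fun g => expENN (-s * N g)) g) := by
        rw [ENNReal.tsum_mul_left]; ring
    _ ≤ (poincareSeries N s)⁻¹ *
        (K * ∑' g, expENN (2 * max C 0) * A.indicator (fun h => expENN (-s * N (γ * h))) g) := by
        exact mul_le_mul_right (mul_le_mul_right (ENNReal.tsum_le_tsum hpt) _) _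
    _ = _ := by rw [ENNReal.tsum_mul_left]; ring

/-- Weak limits of the orbit measures, as the exponent decreases to `1`, are shadow measures. -/
theorem IsContracting.exists_shadowMeasure (ho : IsContracting o)
    (hN : IsCoarselyAdditive o N) (hQ : ∀ s, 1 < s → poincareSeries N s ≠ ∞) :
    ∃ μ : Measure X, IsShadowMeasure o N μ := by
  set s : ℕ → ℝ := fun n => 1 + 1 / ((n : ℝ) + 1) with hs_def
  have hs1 : ∀ n, 1 < s n := fun n => by
    have : (0 : ℝ) < 1 / ((n : ℝ) + 1) := by positivity
    simp only [hs_def]; linarith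
  have hs0 : ∀ n, 0 ≤ s n := fun n => by linarith [hs1 n]
  have hs2 : ∀ n, s n ≤ 2 := fun n => by
    have : 1 / ((n : ℝ) + 1) ≤ 1 := by
      rw [div_le_one (by positivity)]; linarith [(Nat.cast_nonneg n : (0 : ℝ) ≤ n)]
    simp only [hs_def]; linarith
  have hst : Tendsto s atTop (𝓝 1) := by
    simpa [hs_def] using (tendsto_one_div_add_atTop_nhds_zero_nat (𝕜 := ℝ)).const_add 1
  set P : ℕ → ProbabilityMeasure X := fun n =>
    ⟨orbitMeasure o N (s n), isProbabilityMeasure_orbitMeasure (hQ _ (hs1 n))⟩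
  have hP : ∀ n, (P n : Measure X) = orbitMeasure o N (s n) := fun n => rfl
  clear_value P
  -- An ultrafilter finer than `atTop` converges in the compact space of probability measures, so no
  -- subsequence is extracted.
  set L : Filter ℕ := (hyperfilter ℕ : Filter ℕ)
  have hL : L ≤ atTop := Nat.hyperfilter_le_atTop
  obtain ⟨μ, hμ⟩ : ∃ μ, Tendsto P L (𝓝 μ) := by
    obtain ⟨μ, -, h⟩ := isCompact_univ.ultrafilter_le_nhds (Ultrafilter.map P (hyperfilter ℕ))
      (by simp)
    exact ⟨μ, h⟩
  have hw : ∀ γ, Tendsto (fun n => expENN (-s n * N γ)) L (𝓝 (expENN (-N γ))) := by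
    intro γ
    have h1 : Tendsto (fun n => -s n * N γ) atTop (𝓝 (-N γ)) := by
      simpa using hst.neg.mul_const (N γ)
    exact (continuous_expENN.tendsto _).comp (h1.mono_left hL)
  refine ⟨μ, inferInstance, fun r hr => ?_, ?_⟩
  · obtain ⟨K, hK, hKs⟩ := ho.orbitMeasure_shadow_le hN (half_pos hr)
    refine ⟨K, hK, fun γ => ?_⟩
    -- The upper bound passes to the limit on open sets only, so an open set is placed between the
    -- shadows of radii r and r / 2.
    have hopen : IsOpen {x : X | r / 2 < dist (γ⁻¹ • x) (o γ⁻¹)} :=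
      isOpen_lt continuous_const ((ho.continuous_smul γ⁻¹).dist continuous_const)
    calc (μ : Measure X) (shadow o r γ)
        ≤ (μ : Measure X) {x : X | r / 2 < dist (γ⁻¹ • x) (o γ⁻¹)} :=
          measure_mono fun x hx => (half_lt_self hr).trans_le hx
      _ ≤ L.liminf fun n => (P n : Measure X) {x : X | r / 2 < dist (γ⁻¹ • x) (o γ⁻¹)} :=
          ProbabilityMeasure.le_liminf_measure_open_of_tendsto hμ hopen
      _ ≤ L.liminf fun n => K * expENN (-s n * N γ) := by
          refine liminf_le_liminf (Eventually.of_forall fun n => ?_)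
          rw [hP]
          exact (measure_mono fun x (hx : r / 2 < _) => (hx.le : x ∈ shadow o (r / 2) γ)).trans
            (hKs (s n) (hs0 n) (hs2 n) (hQ _ (hs1 n)) γ)
      _ = K * expENN (-N γ) := (ENNReal.Tendsto.const_mul (hw γ) (Or.inr hK)).liminf_eq
  · obtain ⟨r, hr, K, hK, hKs⟩ := ho.le_orbitMeasure_shadow hN
    refine ⟨r, hr, K, hK, fun r' hr' γ => ?_⟩
    have hK0 : K ≠ 0 := by
      rintro rfl
      have := hKs (s 0) (hs0 0) (hs2 0) (hQ _ (hs1 0)) γ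
      simp [expENN_ne_zero] at this
    have key : K⁻¹ * expENN (-N γ) ≤ (μ : Measure X) (shadow o r γ) := by
      calc K⁻¹ * expENN (-N γ) = L.limsup fun n => K⁻¹ * expENN (-s n * N γ) :=
            (ENNReal.Tendsto.const_mul (hw γ) (Or.inr (ENNReal.inv_ne_top.2 hK0))).limsup_eq.symm
        _ ≤ L.limsup fun n => (P n : Measure X) (shadow o r γ) := by
            refine limsup_le_limsup (Eventually.of_forall fun n => ?_)
            have := hKs (s n) (hs0 n) (hs2 n) (hQ _ (hs1 n)) γ
            calc _ ≤ K⁻¹ * (K * orbitMeasure o N (s n) (shadow o r γ)) 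
                  := mul_le_mul_right this _
              _ = _ := by rw [← mul_assoc, ENNReal.inv_mul_cancel hK0 hK, one_mul, ← hP]
        _ ≤ _ := ProbabilityMeasure.limsup_measure_closed_le_of_tendsto hμ
            (ho.isClosed_shadow r γ)
    calc expENN (-N γ) = K * (K⁻¹ * expENN (-N γ)) := by
          rw [← mul_assoc, ENNReal.mul_inv_cancel hK0 hK, one_mul]
      _ ≤ K * (μ : Measure X) (shadow o r' γ) := by
          gcongr
          exact key.trans (measure_mono (shadow_anti hr' γ))

end Measure

/-! ### Covering by shadows and the second moment method. -/

section Covering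

open MeasureTheory

/-- The Cauchy-Schwarz inequality for a function supported on `A`. -/
theorem lintegral_sq_le {Y : Type*} [MeasurableSpace Y] (ν : Measure Y) {f : Y → ℝ≥0∞}
    (hf : Measurable f) {A : Set Y} (hA : MeasurableSet A) (hfA : ∀ x, x ∉ A → f x = 0) :
    (∫⁻ x, f x ∂ν) ^ 2 ≤ (∫⁻ x, f x ^ 2 ∂ν) * ν A := by
  have hconj : (2 : ℝ).HolderConjugate 2 := Real.HolderConjugate.two_two
  have h := ENNReal.lintegral_mul_le_Lp_mul_Lq ν hconj hf.aemeasurable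
    (measurable_one.indicator hA).aemeasurable (g := A.indicator 1)
  have h1 : ∫⁻ x, (f * A.indicator (1 : Y → ℝ≥0∞)) x ∂ν = ∫⁻ x, f x ∂ν := by
    refine lintegral_congr fun x => ?_
    by_cases hx : x ∈ A
    · simp [hx]
    · simp [hx, hfA x hx]
  have h2 : ∫⁻ x, A.indicator (1 : Y → ℝ≥0∞) x ^ (2 : ℝ) ∂ν = ν A := by
    rw [← lintegral_indicator_one hA]
    refine lintegral_congr fun x => ?_
    by_cases hx : x ∈ A <;> simp [hx]
  rw [h1, h2] at h
  calc (∫⁻ x, f x ∂ν) ^ 2 ≤ ((∫⁻ x, f x ^ (2 : ℝ) ∂ν) ^ (1 / 2 : ℝ) * ν A ^ (1 / 2 : ℝ)) ^ 2 := by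
        gcongr
    _ = _ := by
        rw [mul_pow, ← ENNReal.rpow_natCast, ← ENNReal.rpow_natCast, ← ENNReal.rpow_mul,
          ← ENNReal.rpow_mul]
        norm_num

variable {G X : Type*} [Group G] [Countable G] [MetricSpace X] [MulAction G X] [MeasurableSpace X]
  {o : G → X} {N : G → ℝ} {μ : Measure X} {r : ℝ}

theorem IsContracting.tsum_measure_shadow_inter_le [BorelSpace X] (ho : IsContracting o) {U : Set G}
    (hU : U.PairwiseDisjoint (shadow o r)) {A B : Set X} (hB : MeasurableSet B)
    (hUA : ∀ γ ∈ U, shadow o r γ ⊆ A) :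
    ∑' γ : U, μ (shadow o r γ ∩ B) ≤ μ (A ∩ B) := by
  rw [← measure_biUnion (f := fun γ => shadow o r γ ∩ B) U.to_countable
    (fun a ha b hb hab => (hU ha hb hab).mono Set.inter_subset_left Set.inter_subset_left)
    (fun γ _ => (ho.isClosed_shadow r γ).measurableSet.inter hB)]
  exact measure_mono (Set.iUnion₂_subset fun γ hγ =>
    Set.inter_subset_inter_left _ (hUA γ hγ))

variable [CompactSpace X]

/-- A Vitali covering lemma for shadows. -/
theorem IsShadowMeasure.exists_disjoint_subfamily (ho : IsContracting o)
    (hN : IsCoarselyAdditive o N) (hμ : IsShadowMeasure o N μ) (hr : 0 < r) :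
    ∃ K : ℝ≥0∞, K ≠ ∞ ∧ ∀ T : Set G, ∃ U ⊆ T, U.PairwiseDisjoint (shadow o r) ∧
      μ (⋃ γ ∈ T, shadow o r γ) ≤ K * ∑' γ : U, expENN (-N γ) := by
  obtain ⟨r', hr', C, hnest⟩ := ho.shadow_nested hN hr 1
  obtain ⟨K, hK, hup⟩ := hμ.upper r' hr'
  obtain ⟨B, hB⟩ := exists_forall_neg_le_of_tendsto hN.tendsto
  refine ⟨K, hK, fun T => ?_⟩
  -- Here exp(-N γ) plays the role of the radius; the ratio exp 1 matches the slack 1 given to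
  -- `shadow_nested`.
  obtain ⟨U, hUT, hdisj, hcov⟩ := Vitali.exists_disjoint_subfamily_covering_enlargement
    (shadow o r) {γ ∈ T | (shadow o r γ).Nonempty} (fun γ => Real.exp (-N γ)) (Real.exp 1)
    (by simp) (fun _ _ => (Real.exp_pos _).le) (Real.exp B)
    (fun γ _ => Real.exp_le_exp.2 (by linarith [hB γ])) (fun _ h => h.2)
  refine ⟨U, fun γ h => (hUT h).1, hdisj, ?_⟩
  calc μ (⋃ γ ∈ T, shadow o r γ) ≤ μ (⋃ γ ∈ U, shadow o r' γ) := by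
        refine measure_mono fun x hx => ?_
        obtain ⟨γ, hγ, hxγ⟩ := Set.mem_iUnion₂.1 hx
        obtain ⟨β, hβ, hne, hle⟩ := hcov γ ⟨hγ, x, hxγ⟩
        rw [← Real.exp_add, Real.exp_le_exp] at hle
        rw [Set.inter_comm] at hne
        exact Set.mem_biUnion hβ ((hnest β γ hne (by linarith)).1 hxγ)
    _ ≤ ∑' γ : U, μ (shadow o r' γ) := measure_biUnion_le μ U.to_countable _
    _ ≤ ∑' γ : U, K * expENN (-N γ) := ENNReal.tsum_le_tsum fun γ => hup γ
    _ = _ := ENNReal.tsum_mul_left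

variable [BorelSpace X]

/-- Shadows of elements at which `N` is much larger than `N₁` cover a set of small measure. -/
theorem IsShadowMeasure.measure_biUnion_le (ho : IsContracting o)
    (hN : IsCoarselyAdditive o N) (hμ : IsShadowMeasure o N μ) {N₁ : G → ℝ} {μ₁ : Measure X}
    (hμ₁ : IsShadowMeasure o N₁ μ₁) :
    ∃ r₁ > 0, ∀ r, 0 < r → r ≤ r₁ → ∃ K : ℝ≥0∞, K ≠ ∞ ∧ ∀ (t : ℝ) (T : Set G),
      (∀ γ ∈ T, N₁ γ + t ≤ N γ) → μ (⋃ γ ∈ T, shadow o r γ) ≤ K * expENN (-t) := by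
  obtain ⟨r₁, hr₁, L, hL, hlow⟩ := hμ₁.lower
  refine ⟨r₁, hr₁, fun r hr hrr => ?_⟩
  obtain ⟨K, hK, hV⟩ := hμ.exists_disjoint_subfamily ho hN hr
  have := hμ₁.isProbabilityMeasure
  refine ⟨K * L, ENNReal.mul_ne_top hK hL, fun t T hT => ?_⟩
  obtain ⟨U, hUT, hdisj, hle⟩ := hV T
  calc μ (⋃ γ ∈ T, shadow o r γ) ≤ K * ∑' γ : U, expENN (-N γ) := hle
    -- On T, exp(-N) ≤ exp(-t) exp(-N₁), and exp(-N₁) is dominated by the μ₁-mass of the shadow;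
    -- disjointness bounds the total by the mass of μ₁.
    _ ≤ K * ∑' γ : U, expENN (-t) * (L * μ₁ (shadow o r γ ∩ Set.univ)) := by
        refine mul_le_mul_right (ENNReal.tsum_le_tsum fun γ => ?_) _
        rw [Set.inter_univ]
        refine (expENN_le_mul ?_).trans (mul_le_mul_right (hlow r hrr γ) (expENN (-t)))
        linarith [hT γ (hUT γ.2)]
    _ = K * L * expENN (-t) * ∑' γ : U, μ₁ (shadow o r γ ∩ Set.univ) := by
        rw [ENNReal.tsum_mul_left, ENNReal.tsum_mul_left]; ring
    _ ≤ K * L * expENN (-t) * 1 := by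
        refine mul_le_mul_right ?_ _
        refine (ho.tsum_measure_shadow_inter_le hdisj MeasurableSet.univ
          fun γ _ => Set.subset_univ _).trans ?_
        exact prob_le_one
    _ = _ := mul_one _

/-- If the Poincaré series diverges at `1`, then the points which lie in shadows of infinitely many
elements have positive measure (second moment method). -/
theorem IsShadowMeasure.exists_le_measure_iUnion (ho : IsContracting o)
    (hN : IsCoarselyAdditive o N) (hμ : IsShadowMeasure o N μ)
    (hQ : ∀ s, 1 < s → poincareSeries N s ≠ ∞) (hdiv : poincareSeries N 1 = ∞) :
    ∃ r₁ > 0, ∀ r, 0 < r → r ≤ r₁ → ∃ c : ℝ≥0∞, c ≠ 0 ∧ ∀ F : Finset G,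
      c ≤ μ (⋃ γ ∈ (F : Set G)ᶜ, shadow o r γ) := by
  classical
  obtain ⟨r₁, hr₁, L, hL, hlow⟩ := hμ.lower
  refine ⟨r₁, hr₁, fun r hr hrr => ?_⟩
  obtain ⟨K, hK, hup⟩ := hμ.upper r hr
  obtain ⟨_, -, C, hnest⟩ := ho.shadow_nested hN hr 0
  obtain ⟨B, hB⟩ := exists_forall_neg_le_of_tendsto hN.tendsto
  set M : ℝ≥0∞ := K * expENN (2 * |C| + |B|) with hM
  have hMtop : M ≠ ∞ := ENNReal.mul_ne_top hK (expENN_ne_top _)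
  -- 8 = 2 · 2²: a factor 2 from ordering pairs in the double sum, and 2² from Q ≤ 2 QF.
  set R : ℝ≥0∞ := 8 * L ^ 2 * M with hR
  have hRtop : R ≠ ∞ := by
    refine ENNReal.mul_ne_top (ENNReal.mul_ne_top (by simp) (ENNReal.pow_ne_top hL)) hMtop
  refine ⟨R⁻¹, ENNReal.inv_ne_zero.2 hRtop, fun F => ?_⟩
  set A := ⋃ γ ∈ (F : Set G)ᶜ, shadow o r γ with hA
  have hShm : ∀ γ, MeasurableSet (shadow o r γ) := fun γ => (ho.isClosed_shadow r γ).measurableSet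
  have hAm : MeasurableSet A := MeasurableSet.biUnion (Set.to_countable _) fun γ _ => hShm γ
  have hsum : ∀ s, poincareSeries N s = ∑ γ ∈ F, expENN (-s * N γ) +
      ∑' γ, (F : Set G)ᶜ.indicator (fun γ => expENN (-s * N γ)) γ := by
    intro s
    rw [poincareSeries_eq, sum_eq_tsum_indicator, ← ENNReal.tsum_add]
    exact tsum_congr fun γ =>
      (congrFun (Set.indicator_self_add_compl (F : Set G) fun γ => expENN (-s * N γ)) γ).symm
  -- Divergence at 1 lets s > 1 be chosen so close to 1 that F carries at most half of the (finite)
  -- series.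
  obtain ⟨s, hs1, hs2, hFs⟩ : ∃ s, 1 < s ∧ s ≤ 2 ∧
      ∑ γ ∈ F, expENN (-s * N γ) ≤ ∑' γ, (F : Set G)ᶜ.indicator (fun γ => expENN (-s * N γ)) γ := by
    have hfin : ∀ S : Finset G, ∀ s, ∑ γ ∈ S, expENN (-s * N γ) ≠ ∞ := fun S s =>
      ENNReal.sum_ne_top.2 fun γ _ => expENN_ne_top _
    have htop : ∑' γ, (F : Set G)ᶜ.indicator (fun γ => expENN (-1 * N γ)) γ = ∞ := by
      have := hsum 1
      rw [hdiv] at this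
      exact (ENNReal.add_eq_top.1 this.symm).resolve_left (hfin F 1)
    have hlt : ∑ γ ∈ F, expENN (-1 * N γ) <
        ∑' γ, (F : Set G)ᶜ.indicator (fun γ => expENN (-1 * N γ)) γ :=
      htop ▸ (hfin F 1).lt_top
    rw [ENNReal.tsum_eq_iSup_sum] at hlt
    obtain ⟨S, hS⟩ := lt_iSup_iff.1 hlt
    have hcont : ∀ S : Finset G, ∀ H : Set G, Continuous fun s : ℝ =>
        ∑ γ ∈ S, H.indicator (fun γ => expENN (-s * N γ)) γ := by
      intro S H
      refine continuous_finsetSum _ fun γ _ => ?_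
      by_cases h : γ ∈ H
      · simp only [h, Set.indicator_of_mem]
        exact continuous_expENN.comp (by fun_prop)
      · simp only [h, not_false_eq_true, Set.indicator_of_notMem]
        exact continuous_const
    have hev : ∀ᶠ s in 𝓝[>] (1 : ℝ), ∑ γ ∈ F, expENN (-s * N γ) <
        ∑ γ ∈ S, (F : Set G)ᶜ.indicator (fun γ => expENN (-s * N γ)) γ := by
      have h1 := hcont F Set.univ
      simp only [Set.indicator_univ] at h1
      exact nhdsWithin_le_nhds ((h1.tendsto 1).eventually_lt ((hcont S _).tendsto 1) hS)
    obtain ⟨s, hs, hs'⟩ := (hev.and (Ioc_mem_nhdsGT (show (1 : ℝ) < 2 by norm_num))).exists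
    exact ⟨s, hs'.1, hs'.2, hs.le.trans (ENNReal.sum_le_tsum S)⟩
  set Q := poincareSeries N s with hQdef
  set QF := ∑' γ, (F : Set G)ᶜ.indicator (fun γ => expENN (-s * N γ)) γ with hQF
  have hQle : Q ≤ 2 * QF := by
    rw [hQdef, hsum, two_mul]
    gcongr
  have hQ0 : Q ≠ 0 := poincareSeries_ne_zero s
  have hQtop : Q ≠ ∞ := hQ s hs1
  -- With this weight, a γ times the mass of the shadow of γ is comparable to the term exp(-s N γ)
  -- for γ outside F. So the integral of f = ∑ a γ 1_{shadow γ} controls the tail QF.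
  set a : G → ℝ≥0∞ := (F : Set G)ᶜ.indicator fun γ => expENN (-(s - 1) * N γ) with ha
  have ha_le : ∀ γ, a γ ≤ expENN (-(s - 1) * N γ) := fun γ =>
    Set.indicator_le_self _ _ _
  set f : X → ℝ≥0∞ := fun x => ∑' γ, a γ * (shadow o r γ).indicator 1 x with hf
  have hterm : ∀ γ, Measurable fun x => a γ * (shadow o r γ).indicator (1 : X → ℝ≥0∞) x :=
    fun γ => (measurable_one.indicator (hShm γ)).const_mul _
  have hfm : Measurable f := Measurable.tsum hterm
  have hfA : ∀ x, x ∉ A → f x = 0 := by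
    intro x hx
    refine ENNReal.tsum_eq_zero.2 fun γ => ?_
    by_cases hγ : γ ∈ F
    · simp [ha, hγ]
    · have : x ∉ shadow o r γ := fun h => hx (Set.mem_biUnion (by simpa using hγ) h)
      simp [this]
  have hfirst : QF ≤ L * ∫⁻ x, f x ∂μ := by
    rw [hf, lintegral_tsum fun γ => (hterm γ).aemeasurable, ← ENNReal.tsum_mul_left]
    refine ENNReal.tsum_le_tsum fun γ => ?_
    rw [lintegral_const_mul _ (measurable_one.indicator (hShm γ)), lintegral_indicator_one (hShm γ)]
    by_cases hγ : γ ∈ (F : Set G)ᶜ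
    · rw [ha, Set.indicator_of_mem hγ, Set.indicator_of_mem hγ]
      calc expENN (-s * N γ) = expENN (-(s - 1) * N γ) * expENN (-N γ) := by
            rw [← expENN_add]; ring_nf
        _ ≤ expENN (-(s - 1) * N γ) * (L * μ (shadow o r γ)) :=
            mul_le_mul_right (hlow r hrr γ) _
        _ = _ := by ring
    · rw [Set.indicator_of_notMem hγ]; exact zero_le
  set t : G → G → ℝ≥0∞ := fun α β =>
    if N α ≤ N β then a α * a β * μ (shadow o r α ∩ shadow o r β) else 0 with ht
  -- Only pairs with meeting shadows contribute; for them N β is at least N α + N (α⁻¹ β) up to a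
  -- constant. Thus the double sum is bounded by the product of two Poincaré series.
  have ht_le : ∀ α β, t α β ≤ M * (expENN (-s * N α) * expENN (-s * N (α⁻¹ * β))) := by
    intro α β
    by_cases hαβ : N α ≤ N β
    swap
    · simp [ht, hαβ]
    by_cases hne : (shadow o r α ∩ shadow o r β).Nonempty
    swap
    · simp [ht, Set.not_nonempty_iff_eq_empty.1 hne]
    have h1 := (hnest α β hne (by linarith)).2
    simp only [ht, hαβ, if_true]
    calc a α * a β * μ (shadow o r α ∩ shadow o r β)
        ≤ expENN (-(s - 1) * N α) * expENN (-(s - 1) * N β) * (K * expENN (-N β)) := by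
          gcongr
          · exact ha_le α
          · exact ha_le β
          · exact (measure_mono Set.inter_subset_right).trans (hup β)
      _ = K * expENN (-(s - 1) * N α + -(s - 1) * N β + -N β) := by
          rw [expENN_add, expENN_add]; ring
      _ ≤ K * (expENN (2 * |C| + |B|) * expENN (-s * N α + -s * N (α⁻¹ * β))) := by
          refine mul_le_mul_right (expENN_le_mul ?_) _
          have h2 : s * (N α + N (α⁻¹ * β)) ≤ s * (N β + C) := by gcongr
          have h3 : s * C ≤ 2 * |C| := by
            nlinarith [le_abs_self C, abs_nonneg C]
          -- The total exponent is -(s-1) N α - s N β; its first term is harmless because N is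
          -- bounded below.
          have h4 : -(s - 1) * N α ≤ |B| := by
            nlinarith [le_abs_self B, abs_nonneg B, hB α]
          nlinarith
      _ = _ := by rw [expENN_add (-s * N α), hM]; ring
  have hsecond : ∫⁻ x, f x ^ 2 ∂μ ≤ 2 * (M * Q ^ 2) := by
    have hsq : ∀ x, f x ^ 2 = ∑' α, ∑' β,
        a α * a β * (shadow o r α ∩ shadow o r β).indicator 1 x := by
      intro x
      rw [sq, hf, ← ENNReal.tsum_mul_right]
      refine tsum_congr fun α => ?_
      rw [← ENNReal.tsum_mul_left]
      refine tsum_congr fun β => ?_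
      rw [Set.inter_indicator_one]
      simp only [Pi.mul_apply]
      ring
    have hm : ∀ α β, Measurable fun x =>
        a α * a β * (shadow o r α ∩ shadow o r β).indicator (1 : X → ℝ≥0∞) x := fun α β =>
      (measurable_one.indicator ((hShm α).inter (hShm β))).const_mul _
    have hsum : ∑' α, ∑' β, t α β ≤ M * Q ^ 2 := by
      calc ∑' α, ∑' β, t α β
          ≤ ∑' α, ∑' β, M * (expENN (-s * N α) * expENN (-s * N (α⁻¹ * β))) :=
            ENNReal.tsum_le_tsum fun α => ENNReal.tsum_le_tsum fun β => ht_le α β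
        _ = ∑' α, M * (expENN (-s * N α) * Q) := by
            refine tsum_congr fun α => ?_
            rw [ENNReal.tsum_mul_left, ENNReal.tsum_mul_left, hQdef, poincareSeries_eq]
            congr 2
            exact (Equiv.mulLeft α⁻¹).tsum_eq fun h => expENN (-s * N h)
        _ = _ := by
            rw [ENNReal.tsum_mul_left, ENNReal.tsum_mul_right, ← poincareSeries_eq, sq]
    calc ∫⁻ x, f x ^ 2 ∂μ = ∑' α, ∑' β, a α * a β * μ (shadow o r α ∩ shadow o r β) := by
          simp_rw [hsq]
          rw [lintegral_tsum fun α => (Measurable.tsum (hm α)).aemeasurable]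
          refine tsum_congr fun α => ?_
          rw [lintegral_tsum fun β => (hm α β).aemeasurable]
          refine tsum_congr fun β => ?_
          rw [lintegral_const_mul _ (measurable_one.indicator ((hShm α).inter (hShm β))),
            lintegral_indicator_one ((hShm α).inter (hShm β))]
      _ ≤ ∑' α, ∑' β, (t α β + t β α) := by
          refine ENNReal.tsum_le_tsum fun α => ENNReal.tsum_le_tsum fun β => ?_
          rcases le_total (N α) (N β) with h | h
          · refine le_trans (le_of_eq ?_) le_self_add
            simp [ht, h]
          · refine le_trans (le_of_eq ?_) le_add_self
            simp only [ht, h, if_true]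
            rw [mul_comm (a α), Set.inter_comm]
      _ = ∑' α, ∑' β, t α β + ∑' α, ∑' β, t α β := by
          simp_rw [ENNReal.tsum_add]
          congr 1
          exact ENNReal.tsum_comm
      _ ≤ _ := by rw [two_mul]; gcongr
  have hfinal : QF ^ 2 ≤ QF ^ 2 * (R * μ A) := by
    calc QF ^ 2 ≤ (L * ∫⁻ x, f x ∂μ) ^ 2 := by gcongr
      _ = L ^ 2 * (∫⁻ x, f x ∂μ) ^ 2 := mul_pow _ _ _
      _ ≤ L ^ 2 * (2 * (M * (2 * QF) ^ 2) * μ A) := by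
          refine mul_le_mul_right ((lintegral_sq_le μ hfm hAm hfA).trans ?_) _
          refine mul_le_mul_left (hsecond.trans ?_) _
          gcongr
      _ = _ := by rw [hR]; ring
  have hQF0 : QF ^ 2 ≠ 0 := by
    refine pow_ne_zero _ fun h => hQ0 ?_
    simpa [h] using hQle
  have hQFtop : QF ^ 2 ≠ ∞ := by
    refine ENNReal.pow_ne_top (ne_top_of_le_ne_top hQtop ?_)
    exact ENNReal.tsum_le_tsum fun γ => Set.indicator_le_self _ _ _
  have hone : 1 ≤ R * μ A := by
    rw [← ENNReal.mul_le_mul_iff_right hQF0 hQFtop, mul_one]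
    exact hfinal
  have hR0 : R ≠ 0 := by
    intro h
    simp [h] at hone
  calc R⁻¹ ≤ R⁻¹ * (R * μ A) := le_mul_of_one_le_right' hone
    _ = μ A := by rw [← mul_assoc, ENNReal.inv_mul_cancel hR0 hRtop, one_mul]

end Covering

/-! ### Convex combinations, conical points and rigidity. -/

section Rigidity

open MeasureTheory

variable {G X : Type*} [Group G] [MetricSpace X] {o : G → X}

variable {N N₀ N₁ : G → ℝ}

theorem abs_convexComb_le {lam a b A B : ℝ} (h₀ : 0 ≤ lam) (h₁ : lam ≤ 1) (ha : |a| ≤ A)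
    (hb : |b| ≤ B) : |lam * a + (1 - lam) * b| ≤ A + B := by
  have hA := (abs_nonneg a).trans ha
  have hB := (abs_nonneg b).trans hb
  rw [abs_le] at *
  constructor <;> nlinarith

theorem IsCoarselyAdditive.convexComb (h₀ : IsCoarselyAdditive o N₀)
    (h₁ : IsCoarselyAdditive o N₁) {lam : ℝ} (hlam₀ : 0 < lam) (hlam₁ : lam < 1) :
    IsCoarselyAdditive o fun g => lam * N₀ g + (1 - lam) * N₁ g where
  tendsto := (h₀.tendsto.const_mul_atTop hlam₀).atTop_add_atTop
    (h₁.tendsto.const_mul_atTop (sub_pos.2 hlam₁))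
  additive ε hε := by
    obtain ⟨C₀, hC₀⟩ := h₀.additive ε hε
    obtain ⟨C₁, hC₁⟩ := h₁.additive ε hε
    refine ⟨C₀ + C₁, fun a h hah => ?_⟩
    refine le_of_eq_of_le ?_ (abs_convexComb_le hlam₀.le hlam₁.le (hC₀ a h hah) (hC₁ a h hah))
    ring_nf
  mul_left f := by
    obtain ⟨C₀, hC₀⟩ := h₀.mul_left f
    obtain ⟨C₁, hC₁⟩ := h₁.mul_left f
    refine ⟨C₀ + C₁, fun g => ?_⟩
    refine le_of_eq_of_le ?_ (abs_convexComb_le hlam₀.le hlam₁.le (hC₀ g) (hC₁ g))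
    ring_nf

/-- An average of two exponents is at most the larger one. -/
theorem poincareSeries_convexComb_le {G : Type*} (N₀ N₁ : G → ℝ) {lam : ℝ} (hlam₀ : 0 ≤ lam)
    (hlam₁ : lam ≤ 1) (s : ℝ) :
    poincareSeries (fun g => lam * N₀ g + (1 - lam) * N₁ g) s ≤
      poincareSeries N₀ s + poincareSeries N₁ s := by
  simp only [poincareSeries_eq]
  rw [← ENNReal.tsum_add]
  refine ENNReal.tsum_le_tsum fun g => ?_
  rcases le_total (-s * N₀ g) (-s * N₁ g) with h | h
  · exact (expENN_mono (by nlinarith)).trans le_add_self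
  · exact (expENN_mono (by nlinarith)).trans le_self_add

theorem countable_of_poincareSeries_ne_top {G : Type*} {N : G → ℝ} {s : ℝ}
    (h : poincareSeries N s ≠ ∞) : Countable G := by
  rw [← Set.countable_univ_iff]
  refine (Summable.countable_support_ennreal h).mono fun g _ => ?_
  exact expENN_ne_zero _

variable [MulAction G X]

/-- The points which lie in the shadows of infinitely many elements. -/
def conicalSet (o : G → X) (r : ℝ) : Set X :=
  ⋂ F : Finset G, ⋃ γ ∈ (F : Set G)ᶜ, shadow o r γ

variable [CompactSpace X] [MeasurableSpace X] [BorelSpace X] {μ : Measure X} {r : ℝ}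

/-- A set which meets every shadow in a definite proportion contains almost every conical point. -/
theorem IsShadowMeasure.measure_conicalSet_diff_eq_zero [Countable G] (ho : IsContracting o)
    (hN : IsCoarselyAdditive o N) (hμ : IsShadowMeasure o N μ) {r' : ℝ} (hr' : 0 < r')
    (hrr : r' ≤ r) {B : Set X} (hB : MeasurableSet B) {K : ℝ≥0∞} (hK : K ≠ ∞)
    (hprop : ∀ γ, expENN (-N γ) ≤ K * μ (shadow o r' γ ∩ B)) :
    μ (conicalSet o r \ B) = 0 := by
  have := hμ.isProbabilityMeasure
  obtain ⟨L, hL, hV⟩ := hμ.exists_disjoint_subfamily ho hN hr'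
  set A := conicalSet o r \ B with hA
  have key : ∀ η : ℝ≥0∞, η ≠ 0 → μ A ≤ L * K * η := by
    intro η hη
    -- V nearly exhausts its measure on A, which is disjoint from B, so V ∩ B has measure at most η.
    obtain ⟨V, hAV, hVo, hVle⟩ := Set.exists_isOpen_le_add A μ hη
    have hVB : μ (V ∩ B) ≤ η := by
      have h1 : μ A + μ (V ∩ B) ≤ μ A + η := by
        calc μ A + μ (V ∩ B) ≤ μ (V \ B) + μ (V ∩ B) := by
              gcongr
              exact fun x hx => ⟨hAV hx, hx.2⟩
          _ = μ V := measure_sdiff_add_inter V hB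
          _ ≤ _ := hVle
      exact (ENNReal.add_le_add_iff_left (measure_ne_top μ A)).1 h1
    obtain ⟨U, hUT, hdisj, hle⟩ := hV {γ | shadow o r' γ ⊆ V}
    -- A conical point lies in shadows of infinitely many elements, and their diameters tend to 0,
    -- so some such shadow lies in V.
    have hcov : A ⊆ ⋃ γ ∈ {γ | shadow o r' γ ⊆ V}, shadow o r' γ := by
      intro x hx
      obtain ⟨ε, hε, hball⟩ := Metric.isOpen_iff.1 hVo x (hAV hx)
      have hfin := Filter.eventually_cofinite.1
        (ho.shadow_near hr' (show 0 < ε / 3 by positivity))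
      obtain ⟨γ, hγ, hxγ⟩ := Set.mem_iUnion₂.1 (Set.mem_iInter.1 hx.1 hfin.toFinset)
      have hγ' : ∀ y ∈ shadow o r' γ, dist y (o γ) ≤ ε / 3 := by
        by_contra hc
        exact hγ (by simpa using hc)
      have hxr' := shadow_anti hrr γ hxγ
      refine Set.mem_biUnion (show γ ∈ {γ | shadow o r' γ ⊆ V} from fun y hy => hball ?_) hxr'
      rw [Metric.mem_ball]
      have h2 := hγ' x hxr'
      rw [dist_comm] at h2
      linarith [hγ' y hy, dist_triangle y (o γ) x]
    calc μ A ≤ L * ∑' γ : U, expENN (-N γ) := (measure_mono hcov).trans hle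
      _ ≤ L * ∑' γ : U, K * μ (shadow o r' γ ∩ B) := by
          gcongr with γ
          exact hprop γ
      _ = L * K * ∑' γ : U, μ (shadow o r' γ ∩ B) := by rw [ENNReal.tsum_mul_left]; ring
      _ ≤ L * K * η := by
          gcongr
          exact (ho.tsum_measure_shadow_inter_le hdisj hB fun γ hγ => hUT hγ).trans hVB
  by_contra h0
  obtain ⟨n, hn, hlt⟩ := ENNReal.exists_nnreal_pos_mul_lt (ENNReal.mul_ne_top hL hK) h0
  rw [mul_comm] at hlt
  exact absurd (key n (by exact_mod_cast hn.ne')) (not_le.2 hlt)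

/-- The lower bound for the tail unions does not depend on F, so it survives continuity from above
along the countable directed family of finite sets. -/
theorem IsShadowMeasure.exists_le_measure_conicalSet [Countable G] (ho : IsContracting o)
    (hN : IsCoarselyAdditive o N) (hμ : IsShadowMeasure o N μ)
    (hQ : ∀ s, 1 < s → poincareSeries N s ≠ ∞) (hdiv : poincareSeries N 1 = ∞) :
    ∃ r₁ > 0, ∀ r, 0 < r → r ≤ r₁ → μ (conicalSet o r) ≠ 0 := by
  classical
  have := hμ.isProbabilityMeasure
  obtain ⟨r₁, hr₁, h⟩ := hμ.exists_le_measure_iUnion ho hN hQ hdiv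
  refine ⟨r₁, hr₁, fun r hr hrr => ?_⟩
  obtain ⟨c, hc, hF⟩ := h r hr hrr
  have heq : μ (conicalSet o r) =
      ⨅ F : Finset G, μ (⋃ γ ∈ (F : Set G)ᶜ, shadow o r γ) := by
    refine Directed.measure_iInter (fun F => ?_) ?_ ⟨∅, measure_ne_top _ _⟩
    · exact (MeasurableSet.biUnion (Set.to_countable _)
        fun γ _ => (ho.isClosed_shadow r γ).measurableSet).nullMeasurableSet
    · refine directed_of_isDirected_le fun F F' hFF' => ?_
      exact Set.biUnion_subset_biUnion_left (Set.compl_subset_compl.2 (Finset.coe_subset.2 hFF'))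
  rw [heq]
  exact fun h0 => hc (le_zero_iff.1 (h0 ▸ le_iInf hF))

end Rigidity

open MeasureTheory in
/-- If the Poincaré series of a proper convex combination of `N₀` and `N₁` diverges at the common
critical exponent, then `N₀` and `N₁` are at bounded distance. -/
theorem IsContracting.exists_abs_sub_le {G X : Type*} [Group G] [MetricSpace X] [MulAction G X]
    [CompactSpace X] {o : G → X} {N₀ N₁ : G → ℝ} (ho : IsContracting o)
    (hN₀ : IsCoarselyAdditive o N₀) (hN₁ : IsCoarselyAdditive o N₁)
    (hQ₀ : ∀ s, 1 < s → poincareSeries N₀ s ≠ ∞) (hQ₁ : ∀ s, 1 < s → poincareSeries N₁ s ≠ ∞)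
    {lam : ℝ} (hlam₀ : 0 < lam) (hlam₁ : lam < 1)
    (hdiv : poincareSeries (fun g => lam * N₀ g + (1 - lam) * N₁ g) 1 = ∞) :
    ∃ K, ∀ g, |N₀ g - N₁ g| ≤ K := by
  borelize X
  have : Countable G := countable_of_poincareSeries_ne_top (hQ₀ 2 (by norm_num))
  set N : G → ℝ := fun g => lam * N₀ g + (1 - lam) * N₁ g with hNdef
  have hN : IsCoarselyAdditive o N := hN₀.convexComb hN₁ hlam₀ hlam₁
  have hQ : ∀ s, 1 < s → poincareSeries N s ≠ ∞ := fun s hs =>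
    ne_top_of_le_ne_top (ENNReal.add_ne_top.2 ⟨hQ₀ s hs, hQ₁ s hs⟩)
      (poincareSeries_convexComb_le N₀ N₁ hlam₀.le hlam₁.le s)
  obtain ⟨μ₀, hμ₀⟩ := ho.exists_shadowMeasure hN₀ hQ₀
  obtain ⟨μ₁, hμ₁⟩ := ho.exists_shadowMeasure hN₁ hQ₁
  obtain ⟨μ, hμ⟩ := ho.exists_shadowMeasure hN hQ
  have := hμ.isProbabilityMeasure
  obtain ⟨r₀, hr₀, hmax₀⟩ := hμ.measure_biUnion_le ho hN hμ₀
  obtain ⟨r₁, hr₁, hmax₁⟩ := hμ.measure_biUnion_le ho hN hμ₁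
  obtain ⟨r₂, hr₂, hcon⟩ := hμ.exists_le_measure_conicalSet ho hN hQ hdiv
  obtain ⟨r₃, hr₃, L, hL, hlow⟩ := hμ.lower
  set r := min (min r₀ r₁) (min r₂ r₃) with hr_def
  have hr : 0 < r := lt_min (lt_min hr₀ hr₁) (lt_min hr₂ hr₃)
  have hrr₀ : r ≤ r₀ := (min_le_left _ _).trans (min_le_left _ _)
  have hrr₁ : r ≤ r₁ := (min_le_left _ _).trans (min_le_right _ _)
  have hrr₂ : r ≤ r₂ := (min_le_right _ _).trans (min_le_left _ _)
  have hrr₃ : r ≤ r₃ := (min_le_right _ _).trans (min_le_right _ _)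
  clear_value r
  obtain ⟨K₀, hK₀, hmax₀⟩ := hmax₀ r hr hrr₀
  obtain ⟨K₁, hK₁, hmax₁⟩ := hmax₁ r hr hrr₁
  have hpos := hcon r hr hrr₂
  have hlow := hlow r hrr₃
  set B : ℝ → Set X := fun t => ⋃ γ ∈ {γ | t < |N₀ γ - N₁ γ|}, shadow o r γ with hB
  have hBm : ∀ t, MeasurableSet (B t) := fun t => MeasurableSet.biUnion (Set.to_countable _)
    fun γ _ => (ho.isClosed_shadow r γ).measurableSet
  obtain ⟨t, ht⟩ : ∃ t, μ (B t) < μ (conicalSet o r) := by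
    -- N - N₁ = λ(N₀ - N₁) and N - N₀ = (1-λ)(N₁ - N₀), so the sign of N₀ - N₁ decides whether to
    -- compare with μ₁ or μ₀.
    have hle : ∀ t, μ (B t) ≤ K₁ * expENN (-(lam * t)) + K₀ * expENN (-((1 - lam) * t)) := by
      intro t
      have hsub : B t ⊆ (⋃ γ ∈ {γ | t < N₀ γ - N₁ γ}, shadow o r γ) ∪
          ⋃ γ ∈ {γ | t < -(N₀ γ - N₁ γ)}, shadow o r γ := by
        refine Set.iUnion₂_subset fun γ hγ => ?_
        rcases lt_abs.1 (show t < |N₀ γ - N₁ γ| from hγ) with h | h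
        · exact (Set.subset_biUnion_of_mem
            (show γ ∈ {γ | t < N₀ γ - N₁ γ} from h)).trans Set.subset_union_left
        · exact (Set.subset_biUnion_of_mem
            (show γ ∈ {γ | t < -(N₀ γ - N₁ γ)} from h)).trans Set.subset_union_right
      refine (measure_mono hsub).trans ((measure_union_le _ _).trans (add_le_add ?_ ?_))
      · refine hmax₁ _ _ fun γ (hγ : t < _) => ?_
        simp only [hNdef]; nlinarith
      · refine hmax₀ _ _ fun γ (hγ : t < _) => ?_
        simp only [hNdef]; nlinarith
    have hlim : ∀ (a : ℝ) (K : ℝ≥0∞), 0 < a → K ≠ ∞ →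
        Tendsto (fun t => K * expENN (-(a * t))) atTop (𝓝 0) := by
      intro a K ha hK
      have h1 : Tendsto (fun t : ℝ => expENN (-(a * t))) atTop (𝓝 0) := by
        rw [← ENNReal.ofReal_zero]
        refine (ENNReal.continuous_ofReal.tendsto 0).comp (Real.tendsto_exp_neg_atTop_nhds_zero.comp
          (tendsto_id.const_mul_atTop ha))
      simpa using ENNReal.Tendsto.const_mul h1 (Or.inr hK)
    have h := (hlim lam K₁ hlam₀ hK₁).add (hlim (1 - lam) K₀ (sub_pos.2 hlam₁) hK₀)
    rw [add_zero] at h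
    obtain ⟨t, ht⟩ := (h.eventually_lt_const (pos_iff_ne_zero.2 hpos)).exists
    exact ⟨t, (hle t).trans_lt ht⟩
  by_contra! hunb
  obtain ⟨S, ρ, hρ, hS⟩ := ho.exists_displacement
  obtain ⟨C₀, hC₀⟩ := hN₀.additive ρ hρ
  obtain ⟨C₁, hC₁⟩ := hN₁.additive ρ hρ
  obtain ⟨C, hC⟩ := hN.additive ρ hρ
  choose E₀ hE₀ using hN₀.mul_left
  choose E₁ hE₁ using hN₁.mul_left
  obtain ⟨E, hE⟩ := ((insert 1 (S : Set G)).toFinite.image fun f => E₀ f + E₁ f).bddAbove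
  -- One t offsets the discrepancy of γ, one t is to remain for γ h'; C₀ + C₁ pays for additivity
  -- and E for moving h by a displacing element.
  obtain ⟨h, hh⟩ := hunb (2 * t + C₀ + C₁ + E)
  set S' : Set G := (fun f => f * h) '' (insert 1 (S : Set G)) with hS'
  have hS'fin : S'.Finite := (S.finite_toSet.insert 1).image _
  obtain ⟨δ, hδ, hmod⟩ := ho.exists_modulus (hS'fin.image (·⁻¹)) hr
  obtain ⟨D, hD⟩ := (hS'fin.image N).bddAbove
  -- If o h is too close to o γ⁻¹, some f in S displaces it, so h or some f h multiplies γ without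
  -- cancellation.
  have hmove : ∀ γ, ∃ h' ∈ S', ρ ≤ dist (o h') (o γ⁻¹) ∧
      2 * t + C₀ + C₁ < |N₀ h' - N₁ h'| := by
    intro γ
    have hbig : ∀ f ∈ insert 1 (S : Set G), 2 * t + C₀ + C₁ < |N₀ (f * h) - N₁ (f * h)| := by
      intro f hf
      have h1 : E₀ f + E₁ f ≤ E := hE ⟨f, hf, rfl⟩
      have h2 : |N₀ h - N₁ h| ≤ |N₀ (f * h) - N₁ (f * h)| + (E₀ f + E₁ f) := by
        have h3 := abs_le.1 (hE₀ f h)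
        have h4 := abs_le.1 (hE₁ f h)
        refine abs_le.2 ⟨?_, ?_⟩ <;>
        linarith [le_abs_self (N₀ (f * h) - N₁ (f * h)), neg_abs_le (N₀ (f * h) - N₁ (f * h))]
      linarith
    by_cases hfar : ρ ≤ dist (o h) (o γ⁻¹)
    · refine ⟨1 * h, ⟨1, Set.mem_insert _ _, rfl⟩, by rwa [one_mul],
        hbig 1 (Set.mem_insert _ _)⟩
    · obtain ⟨f, hf, hfh⟩ := hS (o h)
      refine ⟨f * h, ⟨f, Set.mem_insert_of_mem _ hf, rfl⟩, ?_,
        hbig f (Set.mem_insert_of_mem _ hf)⟩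
      rw [ho.map_mul]
      have := dist_triangle (f • o h) (o γ⁻¹) (o h)
      rw [dist_comm (o γ⁻¹) (o h)] at this
      linarith
  -- Either γ has discrepancy above t and its own shadow lies in B t, or γ h' does, and its shadow
  -- is a definite part of an enlarged shadow of γ because h' ranges over a finite set.
  have hprop : ∀ γ, expENN (-N γ) ≤
      (1 + expENN (D + C)) * L * μ (shadow o (min δ r) γ ∩ B t) := by
    intro γ
    by_cases hγ : t < |N₀ γ - N₁ γ|
    · calc expENN (-N γ) ≤ L * μ (shadow o r γ) := hlow γ
        _ ≤ L * μ (shadow o (min δ r) γ ∩ B t) := by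
            gcongr
            exact Set.subset_inter (shadow_anti (min_le_right _ _) γ)
              (Set.subset_biUnion_of_mem (show γ ∈ {γ | t < |N₀ γ - N₁ γ|} from hγ))
        _ ≤ _ := by
            gcongr
            exact le_mul_of_one_le_left' le_self_add
    · obtain ⟨h', hh', hfar, hbig⟩ := hmove γ
      have hmem : t < |N₀ (γ * h') - N₁ (γ * h')| := by
        have h1 := abs_le.1 (hC₀ γ h' hfar)
        have h2 := abs_le.1 (hC₁ γ h' hfar)
        have h3 := abs_le.1 (not_lt.1 hγ)
        by_contra hc
        have h4 := abs_le.1 (not_lt.1 hc)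
        refine absurd hbig (not_lt.2 (abs_le.2 ⟨?_, ?_⟩)) <;> linarith
      have hsub : shadow o r (γ * h') ⊆ shadow o (min δ r) γ := by
        intro w hw
        change min δ r ≤ dist (γ⁻¹ • w) (o γ⁻¹)
        refine (min_le_left _ _).trans ?_
        by_contra hc
        have h1 := hmod h'⁻¹ ⟨h', hh', rfl⟩ _ _ (not_le.1 hc)
        rw [← ho.map_mul, ← mul_smul, ← mul_inv_rev] at h1
        exact absurd hw (not_le.2 h1)
      have hNle : -N γ ≤ (D + C) + -N (γ * h') := by
        have h1 := (abs_le.1 (hC γ h' hfar)).2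
        have h2 : N h' ≤ D := hD ⟨h', hh', rfl⟩
        linarith
      calc expENN (-N γ) ≤ expENN (D + C) * expENN (-N (γ * h')) := expENN_le_mul hNle
        _ ≤ expENN (D + C) * (L * μ (shadow o r (γ * h'))) := by
            gcongr; exact hlow _
        _ ≤ (1 + expENN (D + C)) * (L * μ (shadow o (min δ r) γ ∩ B t)) := by
            gcongr
            · exact le_add_self
            · exact Set.subset_inter hsub (Set.subset_biUnion_of_mem
                (show γ * h' ∈ {γ | t < |N₀ γ - N₁ γ|} from hmem))
        _ = _ := by ring
  have hzero := hμ.measure_conicalSet_diff_eq_zero (r := r) ho hN (lt_min hδ hr)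
    (min_le_right _ _) (hBm t)
    (ENNReal.mul_ne_top (ENNReal.add_ne_top.2 ⟨ENNReal.one_ne_top, expENN_ne_top _⟩) hL) hprop
  refine absurd ht (not_lt.2 ?_)
  calc μ (conicalSet o r) ≤ μ ((conicalSet o r \ B t) ∪ B t) :=
        measure_mono (by rw [Set.sdiff_union_self]; exact Set.subset_union_left)
    _ ≤ μ (conicalSet o r \ B t) + μ (B t) := measure_union_le _ _
    _ = μ (B t) := by rw [hzero, zero_add]

/-! ### Sequences, convergence dynamics and separation of points. -/

theorem exists_injective_or_const_subseq {G : Type*} (f : ℕ → G) :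
    (∃ φ : ℕ → ℕ, StrictMono φ ∧ Function.Injective (f ∘ φ)) ∨
      ∃ c, ∃ φ : ℕ → ℕ, StrictMono φ ∧ ∀ n, f (φ n) = c := by
  by_cases h : ∃ c, ∃ᶠ n in atTop, f n = c
  · obtain ⟨c, hc⟩ := h
    obtain ⟨φ, hφ, h⟩ := extraction_of_frequently_atTop hc
    exact Or.inr ⟨c, φ, hφ, h⟩
  · left
    push Not at h
    obtain ⟨φ, -, hφ⟩ := exists_seq_of_forall_finset_exists (fun _ : ℕ => True)
      (fun m n => m < n ∧ f n ≠ f m) (fun s _ => by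
        obtain ⟨n, hn⟩ := ((s.eventually_all).2 fun m (_ : m ∈ s) =>
          (eventually_gt_atTop m).and (h (f m))).exists
        exact ⟨n, trivial, hn⟩)
    refine ⟨φ, fun m n hmn => (hφ m n hmn).1, fun m n hmn => ?_⟩
    by_contra hne
    rcases lt_or_gt_of_ne hne with hlt | hlt
    · exact (hφ m n hlt).2 hmn.symm
    · exact (hφ n m hlt).2 hmn

theorem ConvergesAwayFrom.tendsto {X : Type*} [TopologicalSpace X] [T1Space X] {f : ℕ → X → X}
    {x y : X} (h : ConvergesAwayFrom f x y) {u : ℕ → X} {z : X} (hu : Tendsto u atTop (𝓝 z))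
    (hz : z ≠ y) : Tendsto (fun n => f n (u n)) atTop (𝓝 x) := by
  intro U hU
  obtain ⟨V, hV, hev⟩ := h U hU z hz
  rw [isOpen_compl_singleton.nhdsWithin_eq hz] at hV
  change ∀ᶠ n in atTop, f n (u n) ∈ U
  filter_upwards [hev, hu hV] with n hn hn'
  exact hn _ hn'

theorem ConvergesAwayFrom.comp {X : Type*} [TopologicalSpace X] {f : ℕ → X → X} {x y : X}
    (h : ConvergesAwayFrom f x y) {φ : ℕ → ℕ} (hφ : StrictMono φ) :
    ConvergesAwayFrom (fun n => f (φ n)) x y := by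
  intro U hU z hz
  obtain ⟨V, hV, hev⟩ := h U hU z hz
  exact ⟨V, hV, hφ.tendsto_atTop.eventually hev⟩

/-- The inverses converge to the repelling point. -/
theorem ConvergesAwayFrom.tendsto_inverse {X : Type*} [TopologicalSpace X] [CompactSpace X]
    [T1Space X] {f g : ℕ → X → X} {x y : X} (h : ConvergesAwayFrom f x y)
    (hfg : ∀ n z, f n (g n z) = z) {z : X} (hz : z ≠ x) :
    Tendsto (fun n => g n z) atTop (𝓝 y) := by
  intro U hU
  have hK : IsCompact (interior U)ᶜ := isOpen_interior.isClosed_compl.isCompact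
  -- This compact set avoids y, so f n eventually maps it near x, hence off z; then the preimage g n
  -- z lies in U.
  have hev : ∀ᶠ n in atTop, ∀ w ∈ (interior U)ᶜ, f n w ∈ ({z}ᶜ : Set X) := by
    refine hK.induction_on (p := fun s => ∀ᶠ n in atTop, ∀ w ∈ s, f n w ∈ ({z}ᶜ : Set X))
      (by simp) (fun s t hst ht => ht.mono fun n hn w hw => hn w (hst hw))
      (fun s t hs ht => ?_) fun w hw => ?_
    · filter_upwards [hs, ht] with n h1 h2 w hw
      exact hw.elim (h1 w) (h2 w)
    · have hwy : w ≠ y := by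
        rintro rfl
        exact hw (mem_interior_iff_mem_nhds.2 hU)
      obtain ⟨V, hV, hVn⟩ := h {z}ᶜ (isOpen_compl_singleton.mem_nhds hz.symm) w hwy
      rw [isOpen_compl_singleton.nhdsWithin_eq hwy] at hV
      exact ⟨V, mem_nhdsWithin_of_mem_nhds hV, hVn⟩
  change ∀ᶠ n in atTop, g n z ∈ U
  filter_upwards [hev] with n hn
  by_contra hc
  exact hn (g n z) (fun h' => hc (interior_subset h')) (hfg n z)

/-- Of three points, one is away from a given point and has an image away from another one. -/
theorem exists_forall_far {X : Type*} [MetricSpace X] {p q : Fin 3 → X}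
    (hp : Function.Injective p) (hq : Function.Injective q) :
    ∃ η > 0, ∀ a b : X, ∃ i, η ≤ dist (p i) a ∧ η ≤ dist (q i) b := by
  -- A small ball contains at most one of three distinct points, so a and b exclude at most one
  -- index each.
  have hsep : ∀ p : Fin 3 → X, Function.Injective p →
      ∃ η > 0, ∀ a : X, ∀ i j, i ≠ j → dist (p i) a < η → η ≤ dist (p j) a := by
    intro p hp
    have h1 : 0 < dist (p 0) (p 1) := dist_pos.2 (hp.ne (by decide))
    have h2 : 0 < dist (p 0) (p 2) := dist_pos.2 (hp.ne (by decide))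
    have h3 : 0 < dist (p 1) (p 2) := dist_pos.2 (hp.ne (by decide))
    set η := min (dist (p 0) (p 1)) (min (dist (p 0) (p 2)) (dist (p 1) (p 2))) with hη
    have e1 : η ≤ dist (p 0) (p 1) := min_le_left _ _
    have e2 : η ≤ dist (p 0) (p 2) := (min_le_right _ _).trans (min_le_left _ _)
    have e3 : η ≤ dist (p 1) (p 2) := (min_le_right _ _).trans (min_le_right _ _)
    have hη0 : 0 < η := lt_min h1 (lt_min h2 h3)
    have hall : ∀ i j, i ≠ j → η ≤ dist (p i) (p j) := by
      intro i j hij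
      fin_cases i <;> fin_cases j <;> first | exact absurd rfl hij | assumption |
        (rw [dist_comm]; assumption)
    refine ⟨η / 2, by positivity, fun a i j hij hi => ?_⟩
    have := hall i j hij
    have h4 := dist_triangle (p i) a (p j)
    rw [dist_comm a] at h4
    linarith
  obtain ⟨η, hη, h⟩ := hsep p hp
  obtain ⟨η', hη', h'⟩ := hsep q hq
  refine ⟨min η η', lt_min hη hη', fun a b => ?_⟩
  by_contra! hc
  have hbad : ∀ i, dist (p i) a < η ∨ dist (q i) b < η' := by
    intro i
    by_contra! hi
    exact absurd (hc i ((min_le_left _ _).trans hi.1)) (not_lt.2 ((min_le_right _ _).trans hi.2))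
  have hP : ∀ i j, i ≠ j → dist (p i) a < η → ¬ dist (p j) a < η :=
    fun i j hij hi => not_lt.2 (h a i j hij hi)
  have hQ : ∀ i j, i ≠ j → dist (q i) b < η' → ¬ dist (q j) b < η' :=
    fun i j hij hi => not_lt.2 (h' b i j hij hi)
  have a01 := hP 0 1 (by decide)
  have a02 := hP 0 2 (by decide)
  have a12 := hP 1 2 (by decide)
  have b01 := hQ 0 1 (by decide)
  have b02 := hQ 0 2 (by decide)
  have b12 := hQ 1 2 (by decide)
  have c0 := hbad 0
  have c1 := hbad 1
  have c2 := hbad 2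
  tauto

/-! ### Dynamics on the compactification Γ ⊔ M. -/

section

variable {M : Type*} [TopologicalSpace M] {Γ : Subgroup (M ≃ₜ M)}

namespace GroupUnion

instance : MulAction Γ (GroupUnion Γ) where
  smul := act Γ
  one_smul x := by
    rcases x with g | x
    · exact congrArg Sum.inl (one_mul g)
    · rfl
  mul_smul a b x := by
    rcases x with g | x
    · exact congrArg Sum.inl (mul_assoc a b g)
    · rfl

theorem smul_ofGroup (γ g : Γ) : γ • ofGroup Γ g = ofGroup Γ (γ * g) := rfl

theorem smul_ofPoint (γ : Γ) (x : M) : γ • ofPoint Γ x = ofPoint Γ ((γ : M ≃ₜ M) x) := rfl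

theorem ofGroup_ne_ofPoint (g : Γ) (x : M) : ofGroup Γ g ≠ ofPoint Γ x := Sum.inl_ne_inr

theorem ofPoint_injective : Function.Injective (ofPoint Γ) := Sum.inr_injective

theorem ofGroup_injective : Function.Injective (ofGroup Γ) := Sum.inl_injective

theorem exists_eq (x : GroupUnion Γ) : (∃ g, ofGroup Γ g = x) ∨ ∃ m, ofPoint Γ m = x := by
  rcases x with g | m
  · exact Or.inl ⟨g, rfl⟩
  · exact Or.inr ⟨m, rfl⟩

end GroupUnion

open GroupUnion

variable [MetricSpace (GroupUnion Γ)]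

theorem IsCompatibleMetric.continuous_smul (hd : IsCompatibleMetric Γ) (γ : Γ) :
    Continuous fun x : GroupUnion Γ => γ • x :=
  hd.convergence.1 γ

/-- Limits of sequences of distinct group elements are points of `M`. -/
theorem IsCompatibleMetric.exists_ofPoint_eq (hd : IsCompatibleMetric Γ) {g : ℕ → Γ}
    (hg : Function.Injective g) {x : GroupUnion Γ}
    (hx : Tendsto (fun n => ofGroup Γ (g n)) atTop (𝓝 x)) : ∃ m, ofPoint Γ m = x := by
  refine (exists_eq x).resolve_left ?_
  rintro ⟨h, rfl⟩
  let _ : TopologicalSpace Γ := ⊥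
  have : DiscreteTopology Γ := ⟨rfl⟩
  have hnhds : Tendsto g atTop (𝓝 h) := by
    rw [hd.isEmbedding_ofGroup.isInducing.nhds_eq_comap h]
    exact tendsto_comap_iff.2 hx
  rw [nhds_discrete, tendsto_pure] at hnhds
  obtain ⟨n, hn⟩ := eventually_atTop.1 hnhds
  exact absurd (hg ((hn n le_rfl).trans (hn (n + 1) (by lia)).symm)) (by lia)

/-- A sequence of distinct elements has a subsequence with north-south dynamics between limits of
the elements and of their inverses. -/
theorem IsCompatibleMetric.exists_subseq (hd : IsCompatibleMetric Γ) {g : ℕ → Γ}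
    (hg : Function.Injective g) :
    ∃ (x y : M) (φ : ℕ → ℕ), StrictMono φ ∧
      Tendsto (fun n => ofGroup Γ (g (φ n))) atTop (𝓝 (ofPoint Γ x)) ∧
      Tendsto (fun n => ofGroup Γ (g (φ n))⁻¹) atTop (𝓝 (ofPoint Γ y)) ∧
      ConvergesAwayFrom (fun n (z : GroupUnion Γ) => g (φ n) • z) (ofPoint Γ x) (ofPoint Γ y) := by
  have := hd.compact
  obtain ⟨x, y, φ, hφ, hconv⟩ := hd.convergence.2 g hg
  have hconv : ConvergesAwayFrom (fun n (z : GroupUnion Γ) => g (φ n) • z) x y := hconv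
  have hinj : Function.Injective fun n => g (φ n) := hg.comp hφ.injective
  have hinv : ∀ z, z ≠ x → Tendsto (fun n => (g (φ n))⁻¹ • z) atTop (𝓝 y) := fun z hz =>
    hconv.tendsto_inverse (g := fun n z => (g (φ n))⁻¹ • z) (fun n z => smul_inv_smul _ _) hz
  -- It is not yet known that x lies in M, so an orbit point other than x serves as base point to
  -- show that y does; then 1 can serve for x.
  obtain ⟨k, hk⟩ : ∃ k, ofGroup Γ (g k) ≠ x := by
    by_contra! hc
    exact absurd (hg (ofGroup_injective ((hc 0).trans (hc 1).symm))) (by decide)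
  have hinj' : Function.Injective fun n => (g (φ n))⁻¹ * g k := fun m n hmn =>
    hinj (inv_injective (mul_right_cancel hmn))
  obtain ⟨y, rfl⟩ := hd.exists_ofPoint_eq hinj' (hinv _ hk)
  have hx := hconv.tendsto (tendsto_const_nhds (x := ofGroup Γ 1)) (ofGroup_ne_ofPoint 1 y)
  simp only [smul_ofGroup, mul_one] at hx
  obtain ⟨x, rfl⟩ := hd.exists_ofPoint_eq hinj hx
  have hy := hinv _ (ofGroup_ne_ofPoint 1 x)
  simp only [smul_ofGroup, mul_one] at hy
  exact ⟨x, y, φ, hφ, hx, hy, hconv⟩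

/-- A failure for infinitely many elements would, after passing to subsequences, give points
accumulating away from the repelling point whose images stay away from the attracting one. -/
theorem IsCompatibleMetric.contracting (hd : IsCompatibleMetric Γ) {ε : ℝ} (hε : 0 < ε) {η : ℝ}
    (hη : 0 < η) : ∀ᶠ h : Γ in cofinite, ∀ x : GroupUnion Γ,
      ε ≤ dist x (ofGroup Γ h⁻¹) → dist (h • x) (ofGroup Γ h) ≤ η := by
  have := hd.compact
  by_contra hc
  rw [Filter.eventually_cofinite] at hc
  have hinf : Set.Infinite {h : Γ | ¬ ∀ x : GroupUnion Γ,
    ε ≤ dist x (ofGroup Γ h⁻¹) → dist (h • x) (ofGroup Γ h) ≤ η} := hc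
  set g : ℕ → Γ := fun n => hinf.natEmbedding _ n with hg_def
  have hg : Function.Injective g := Subtype.val_injective.comp (hinf.natEmbedding _).injective
  have hbad : ∀ n, ∃ x : GroupUnion Γ,
      ε ≤ dist x (ofGroup Γ (g n)⁻¹) ∧ η < dist (g n • x) (ofGroup Γ (g n)) := by
    intro n
    have := (hinf.natEmbedding _ n).2
    simpa only [Set.mem_ofPred_eq, not_forall, exists_prop, not_le] using this
  choose z hz using hbad
  obtain ⟨x, y, φ, hφ, hx, hy, hconv⟩ := hd.exists_subseq hg
  obtain ⟨w, ψ, hψ, hw⟩ := CompactSpace.tendsto_subseq fun n => z (φ n)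
  have hne : w ≠ ofPoint Γ y := by
    have h1 : ε ≤ dist w (ofPoint Γ y) :=
      ge_of_tendsto' (hw.dist (hy.comp hψ.tendsto_atTop)) fun n => (hz (φ (ψ n))).1
    exact dist_pos.1 (hε.trans_le h1)
  have h2 := ((hconv.comp hψ).tendsto hw hne).dist (hx.comp hψ.tendsto_atTop)
  have h3 := ge_of_tendsto' h2 fun n => (hz (φ (ψ n))).2.le
  rw [dist_self] at h3
  exact absurd h3 (not_le.2 hη)

/-- Convergence of the elements and of their inverses determines the dynamics. -/
theorem IsCompatibleMetric.tendsto_smul (hd : IsCompatibleMetric Γ) {g : ℕ → Γ}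
    (hg : Function.Injective g) {x y z : GroupUnion Γ} {u : ℕ → GroupUnion Γ}
    (hx : Tendsto (fun n => ofGroup Γ (g n)) atTop (𝓝 x))
    (hy : Tendsto (fun n => ofGroup Γ (g n)⁻¹) atTop (𝓝 y))
    (hu : Tendsto u atTop (𝓝 z)) (hz : z ≠ y) :
    Tendsto (fun n => g n • u n) atTop (𝓝 x) := by
  have hpos : 0 < dist z y := dist_pos.2 hz
  have hfar : ∀ᶠ n in atTop, dist z y / 2 ≤ dist (u n) (ofGroup Γ (g n)⁻¹) :=
    ((hu.dist hy).eventually_const_lt (half_lt_self hpos)).mono fun n hn => hn.le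
  have hcof : Tendsto g atTop cofinite := Nat.cofinite_eq_atTop ▸ hg.tendsto_cofinite
  have hclose : Tendsto (fun n => dist (g n • u n) (ofGroup Γ (g n))) atTop (𝓝 0) := by
    rw [Metric.tendsto_nhds]
    intro η hη
    filter_upwards [hfar, hcof.eventually (hd.contracting (half_pos hpos) (half_pos hη))]
      with n h1 h2
    rw [Real.dist_0_eq_abs, abs_of_nonneg dist_nonneg]
    linarith [h2 _ h1]
  refine (tendsto_iff_of_dist ?_).2 hx
  exact hclose

/-- Points of the limit set are limits of group elements. -/
theorem IsCompatibleMetric.exists_seq_of_mem_limitSet (hd : IsCompatibleMetric Γ)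
    (hM : ∀ u v : M, ∃ z, z ≠ u ∧ z ≠ v) {p : M} (hp : p ∈ limitSet Γ) :
    ∃ (g : ℕ → Γ) (y : M), Function.Injective g ∧
      Tendsto (fun n => ofGroup Γ (g n)) atTop (𝓝 (ofPoint Γ p)) ∧
      Tendsto (fun n => ofGroup Γ (g n)⁻¹) atTop (𝓝 (ofPoint Γ y)) := by
  have : T2Space M := hd.isEmbedding_ofPoint.t2Space
  obtain ⟨y, g, hconv⟩ := hp
  rcases exists_injective_or_const_subseq g with ⟨φ, hφ, hinj⟩ | ⟨c, φ, hφ, hc⟩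
  · obtain ⟨x, y', ψ, hψ, hx, hy, hconv'⟩ := hd.exists_subseq hinj
    obtain ⟨z, hzy, hzy'⟩ := hM y y'
    have h1 := (hconv.comp (hφ.comp hψ)).tendsto (tendsto_const_nhds (x := z)) hzy
    have h2 := hconv'.tendsto (tendsto_const_nhds (x := ofPoint Γ z))
      (ofPoint_injective.ne hzy')
    have h3 := (hd.isEmbedding_ofPoint.continuous.tendsto p).comp h1
    obtain rfl : x = p := ofPoint_injective (tendsto_nhds_unique h2 h3)
    exact ⟨_, y', hinj.comp hψ.injective, hx, hy⟩
  · have hcp : ∀ z, z ≠ y → (c : M ≃ₜ M) z = p := by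
      intro z hz
      have h1 := (hconv.comp hφ).tendsto (tendsto_const_nhds (x := z)) hz
      simp only [hc] at h1
      exact tendsto_nhds_unique tendsto_const_nhds h1
    obtain ⟨z, hz, -⟩ := hM y y
    obtain ⟨w, hw, hwz⟩ := hM y z
    exact absurd ((c : M ≃ₜ M).injective ((hcp w hw).trans (hcp z hz).symm)) hwz

end

open GroupUnion

/-! ### Coarse-cocycles and their magnitudes. -/

section Cocycle

variable {M : Type*} [TopologicalSpace M] {Γ : Subgroup (M ≃ₜ M)} {κ : ℝ} {σ : Γ → M → ℝ}

theorem IsKappaCoarseCocycle.exists_abs_le [CompactSpace M] (h : IsKappaCoarseCocycle Γ κ σ)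
    (γ : Γ) : ∃ C, ∀ x, |σ γ x| ≤ C := by
  have : ∃ C, ∀ x ∈ (Set.univ : Set M), |σ γ x| ≤ C := by
    refine isCompact_univ.induction_on (p := fun s => ∃ C, ∀ x ∈ s, |σ γ x| ≤ C) ⟨0, by simp⟩
      (fun s t hst ⟨C, hC⟩ => ⟨C, fun x hx => hC x (hst hx)⟩)
      (fun s t ⟨C, hC⟩ ⟨D, hD⟩ => ⟨max C D, fun x hx => ?_⟩) fun x₀ _ => ?_
    · exact hx.elim (fun h => (hC x h).trans (le_max_left _ _))
        fun h => (hD x h).trans (le_max_right _ _)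
    · refine ⟨_, mem_nhdsWithin_of_mem_nhds (h.coarselyContinuous γ x₀ 1 one_pos),
        |σ γ x₀| + (κ + 1), fun x hx => ?_⟩
      have hx : |σ γ x₀ - σ γ x| ≤ κ + 1 := hx
      have := abs_sub_abs_le_abs_sub (σ γ x) (σ γ x₀)
      rw [abs_sub_comm] at this
      linarith
  obtain ⟨C, hC⟩ := this
  exact ⟨C, fun x => hC x trivial⟩

theorem IsKappaCoarseCocycle.convexComb {κ₀ κ₁ : ℝ} {σ₀ σ₁ : Γ → M → ℝ}
    (h₀ : IsKappaCoarseCocycle Γ κ₀ σ₀) (h₁ : IsKappaCoarseCocycle Γ κ₁ σ₁) {lam : ℝ}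
    (hlam₀ : 0 ≤ lam) (hlam₁ : lam ≤ 1) :
    IsKappaCoarseCocycle Γ (κ₀ + κ₁) fun γ x => lam * σ₀ γ x + (1 - lam) * σ₁ γ x where
  coarselyContinuous γ x₀ ε hε := by
    filter_upwards [h₀.coarselyContinuous γ x₀ (ε / 2) (half_pos hε),
      h₁.coarselyContinuous γ x₀ (ε / 2) (half_pos hε)] with x hx₀ hx₁
    have := abs_convexComb_le hlam₀ hlam₁ hx₀ hx₁
    refine le_trans (le_of_eq ?_) (this.trans (by linarith))
    ring_nf
  coarseCocycle a b x := by
    refine le_of_eq_of_le ?_ (abs_convexComb_le hlam₀ hlam₁ (h₀.coarseCocycle a b x)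
      (h₁.coarseCocycle a b x))
    ring_nf

/-- If `b` is a global fixed point, then the cocycle at `b` is bounded on the conjugates of an
element. -/
theorem IsKappaCoarseCocycle.exists_conj_le {b : M} (hσ : IsKappaCoarseCocycle Γ κ σ)
    (hb : ∀ γ : Γ, (γ : M ≃ₜ M) b = b) (g : Γ) : ∃ C, ∀ γ : Γ, σ (γ * g * γ⁻¹) b ≤ C := by
  refine ⟨σ 1 b + σ g b + 3 * κ, fun γ => ?_⟩
  have h1 := abs_le.1 (hσ.coarseCocycle (γ * g) γ⁻¹ b)
  have h2 := abs_le.1 (hσ.coarseCocycle γ g b)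
  have h3 := abs_le.1 (hσ.coarseCocycle γ γ⁻¹ b)
  rw [hb] at h1 h2 h3
  rw [mul_inv_cancel] at h3
  linarith

theorem IsNonelementary.exists_mem_ne (hne : IsNonelementary Γ) (u v : M) :
    ∃ z ∈ limitSet Γ, z ≠ u ∧ z ≠ v := by
  by_contra! hc
  have hsub : limitSet Γ ⊆ {u, v} := by
    intro z hz
    by_cases h : z = u
    · exact Or.inl h
    · exact Or.inr (hc z hz h)
  have h1 : (3 : ℕ∞) ≤ 2 := hne.trans ((Set.encard_le_encard hsub).trans ((Set.encard_insert_le _ _).trans (by rw [Set.encard_singleton]; norm_num)))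
  exact absurd h1 (by norm_num)

theorem IsNonelementary.exists_injective (hne : IsNonelementary Γ) :
    ∃ p : Fin 3 → M, Function.Injective p := by
  obtain ⟨a, -⟩ := Set.nonempty_of_encard_ne_zero (s := limitSet Γ) fun h => by
    rw [IsNonelementary, h] at hne
    exact absurd hne (by norm_num)
  obtain ⟨b, -, hba, -⟩ := hne.exists_mem_ne a a
  obtain ⟨c, -, hca, hcb⟩ := hne.exists_mem_ne a b
  refine ⟨![a, b, c], fun i j hij => ?_⟩
  fin_cases i <;> fin_cases j <;> simp_all

variable [MetricSpace (GroupUnion Γ)] {N : Γ → ℝ}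

theorem IsMagnitude.convexComb {σ₀ σ₁ : Γ → M → ℝ} {N₀ N₁ : Γ → ℝ} (h₀ : IsMagnitude Γ σ₀ N₀)
    (h₁ : IsMagnitude Γ σ₁ N₁) {lam : ℝ} (hlam₀ : 0 ≤ lam) (hlam₁ : lam ≤ 1) :
    IsMagnitude Γ (fun γ x => lam * σ₀ γ x + (1 - lam) * σ₁ γ x)
      fun γ => lam * N₀ γ + (1 - lam) * N₁ γ := by
  intro ε hε
  obtain ⟨C₀, hC₀, h₀⟩ := h₀ ε hε
  obtain ⟨C₁, hC₁, h₁⟩ := h₁ ε hε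
  refine ⟨C₀ + C₁, by positivity, fun x γ hx => ?_⟩
  obtain ⟨a, b⟩ := h₀ x γ hx
  obtain ⟨c, d⟩ := h₁ x γ hx
  constructor <;> nlinarith

theorem IsExpanding.convexComb {σ₀ σ₁ : Γ → M → ℝ} (h₀ : IsExpanding Γ σ₀)
    (h₁ : IsExpanding Γ σ₁) {lam : ℝ} (hlam₀ : 0 < lam) (hlam₁ : lam < 1) :
    IsExpanding Γ fun γ x => lam * σ₀ γ x + (1 - lam) * σ₁ γ x where
  isCoarseCocycle := by
    obtain ⟨κ₀, hκ₀⟩ := h₀.isCoarseCocycle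
    obtain ⟨κ₁, hκ₁⟩ := h₁.isCoarseCocycle
    exact ⟨_, hκ₀.convexComb hκ₁ hlam₀.le hlam₁.le⟩
  proper g p m hg hlox hdist :=
    ((h₀.proper g p m hg hlox hdist).const_mul_atTop hlam₀).atTop_add_atTop
      ((h₁.proper g p m hg hlox hdist).const_mul_atTop (sub_pos.2 hlam₁))
  exists_magnitude := by
    obtain ⟨N₀, hN₀⟩ := h₀.exists_magnitude
    obtain ⟨N₁, hN₁⟩ := h₁.exists_magnitude
    exact ⟨_, hN₀.convexComb hN₁ hlam₀.le hlam₁.le⟩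

/-- A magnitude controls the cocycle at points which are at least `ε` away from the inverse. -/
theorem IsMagnitude.exists_abs_sub_le (hN : IsMagnitude Γ σ N) {ε : ℝ} (hε : 0 < ε) :
    ∃ C, ∀ (x : M) (γ : Γ), ε ≤ dist (ofPoint Γ x) (ofGroup Γ γ⁻¹) → |σ γ x - N γ| ≤ C := by
  obtain ⟨C, -, h⟩ := hN (ε / 2) (half_pos hε)
  refine ⟨C, fun x γ hx => abs_le.2 ?_⟩
  obtain ⟨a, b⟩ := h x γ (by linarith)
  constructor <;> linarith

/-- Two magnitudes of the same cocycle are at bounded distance. -/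
theorem IsMagnitude.exists_abs_sub_le_of_isMagnitude {p : Fin 3 → M} (hp : Function.Injective p)
    (hN : IsMagnitude Γ σ N) {N' : Γ → ℝ} (hN' : IsMagnitude Γ σ N') :
    ∃ C, ∀ γ, |N γ - N' γ| ≤ C := by
  have hp' := (ofPoint_injective (Γ := Γ)).comp hp
  obtain ⟨η, hη, hfar⟩ := exists_forall_far hp' hp'
  obtain ⟨C, hC⟩ := hN.exists_abs_sub_le hη
  obtain ⟨C', hC'⟩ := hN'.exists_abs_sub_le hη
  refine ⟨C + C', fun γ => ?_⟩
  obtain ⟨i, hi, -⟩ := hfar (ofGroup Γ γ⁻¹) (ofGroup Γ γ⁻¹)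
  have h1 := abs_le.1 (hC _ γ hi)
  have h2 := abs_le.1 (hC' _ γ hi)
  refine abs_le.2 ⟨?_, ?_⟩ <;> linarith

/-- Magnitudes are coarsely additive. -/
theorem IsMagnitude.isCoarselyAdditive [CompactSpace M] (hd : IsCompatibleMetric Γ)
    (hσ : IsKappaCoarseCocycle Γ κ σ) {p : Fin 3 → M} (hp : Function.Injective p)
    (hN : IsMagnitude Γ σ N) (htop : Tendsto N cofinite atTop) :
    IsCoarselyAdditive (ofGroup Γ) N where
  tendsto := htop
  additive ε hε := by
    choose Cσ hCσ using hσ.exists_abs_le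
    have hp' := (ofPoint_injective (Γ := Γ)).comp hp
    obtain ⟨η, hη, hfar⟩ := exists_forall_far hp' hp'
    obtain ⟨C₁, hC₁⟩ := hN.exists_abs_sub_le hη
    have hS := Filter.eventually_cofinite.1 (hd.contracting hη (half_pos hε))
    set S : Set Γ := {h | ¬ ∀ x : GroupUnion Γ, η ≤ dist x (ofGroup Γ h⁻¹) →
      dist (h • x) (ofGroup Γ h) ≤ ε / 2}
    -- a point at which the cocycle of `h`, of `a` and of `a * h` are all controlled
    have key : ∃ η' > 0, ∃ C', ∀ a h : Γ, ε ≤ dist (ofGroup Γ h) (ofGroup Γ a⁻¹) → ∃ x : M,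
        η' ≤ dist (ofPoint Γ x) (ofGroup Γ (a * h)⁻¹) ∧
        η' ≤ dist (ofPoint Γ ((h : M ≃ₜ M) x)) (ofGroup Γ a⁻¹) ∧ |σ h x - N h| ≤ C' := by
      -- For each of the finitely many exceptional h, the triples p and h p are both separated, so
      -- some p i meets both distance conditions.
      have hfin : ∃ η' > 0, ∃ C', ∀ h ∈ S, ∀ a : Γ, ∃ x : M,
          η' ≤ dist (ofPoint Γ x) (ofGroup Γ (a * h)⁻¹) ∧
          η' ≤ dist (ofPoint Γ ((h : M ≃ₜ M) x)) (ofGroup Γ a⁻¹) ∧ |σ h x - N h| ≤ C' := by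
        clear_value S
        induction S, hS using Set.Finite.induction_on with
        | empty => exact ⟨1, one_pos, 0, by simp⟩
        | @insert g T _ _ ih =>
          obtain ⟨η₁, hη₁, C', ih⟩ := ih
          obtain ⟨η₂, hη₂, hfar₂⟩ := exists_forall_far hp'
            (q := fun i => ofPoint Γ ((g : M ≃ₜ M) (p i)))
            (ofPoint_injective.comp ((g : M ≃ₜ M).injective.comp hp))
          refine ⟨min η₁ η₂, lt_min hη₁ hη₂, max C' (Cσ g + |N g|), fun h hh a => ?_⟩
          rcases hh with rfl | hh
          · obtain ⟨i, hi, hi'⟩ := hfar₂ (ofGroup Γ (a * h)⁻¹) (ofGroup Γ a⁻¹)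
            refine ⟨p i, (min_le_right _ _).trans hi, (min_le_right _ _).trans hi',
              le_trans ?_ (le_max_right _ _)⟩
            exact (abs_sub _ _).trans (by gcongr; exact hCσ h _)
          · obtain ⟨x, h1, h2, h3⟩ := ih h hh a
            exact ⟨x, (min_le_left _ _).trans h1, (min_le_left _ _).trans h2,
              h3.trans (le_max_left _ _)⟩
      obtain ⟨η', hη', C', hfin⟩ := hfin
      refine ⟨min η' (min η (ε / 2)), lt_min hη' (lt_min hη (half_pos hε)), max C' C₁,
        fun a h hah => ?_⟩
      by_cases hh : h ∈ S
      · obtain ⟨x, h1, h2, h3⟩ := hfin h hh a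
        exact ⟨x, (min_le_left _ _).trans h1, (min_le_left _ _).trans h2,
          h3.trans (le_max_left _ _)⟩
      -- A point away from h⁻¹ is mapped to within ε / 2 of h, hence stays ε / 2 away from a⁻¹.
      · obtain ⟨i, hi, hi'⟩ := hfar (ofGroup Γ (a * h)⁻¹) (ofGroup Γ h⁻¹)
        have hcontr : ∀ x : GroupUnion Γ, η ≤ dist x (ofGroup Γ h⁻¹) →
            dist (h • x) (ofGroup Γ h) ≤ ε / 2 := not_not.1 hh
        have h1 := hcontr _ hi'
        refine ⟨p i, ((min_le_right _ _).trans (min_le_left _ _)).trans hi,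
          ((min_le_right _ _).trans (min_le_right _ _)).trans ?_,
          (hC₁ _ h hi').trans (le_max_right _ _)⟩
        change ε / 2 ≤ dist (h • ofPoint Γ (p i)) (ofGroup Γ a⁻¹)
        have h2 := dist_triangle (ofGroup Γ h) (h • ofPoint Γ (p i)) (ofGroup Γ a⁻¹)
        rw [dist_comm (ofGroup Γ h) (h • ofPoint Γ (p i))] at h2
        have h3 : dist (h • ofPoint Γ (p i)) (ofGroup Γ h) ≤ ε / 2 := h1
        linarith
    obtain ⟨η', hη', C', key⟩ := key
    obtain ⟨C, hC⟩ := hN.exists_abs_sub_le hη'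
    refine ⟨C + C + C' + κ, fun a h hah => ?_⟩
    obtain ⟨x, h1, h2, h3⟩ := key a h hah
    have e1 := abs_le.1 (hC x (a * h) h1)
    have e2 := abs_le.1 (hC _ a h2)
    have e3 := abs_le.1 h3
    have e4 := abs_le.1 (hσ.coarseCocycle a h x)
    refine abs_le.2 ⟨?_, ?_⟩ <;> linarith
  mul_left f := by
    obtain ⟨Cσ, hCσ⟩ := hσ.exists_abs_le f
    have hp' := (ofPoint_injective (Γ := Γ)).comp hp
    obtain ⟨η, hη, hfar⟩ := exists_forall_far hp' hp'
    obtain ⟨C, hC⟩ := hN.exists_abs_sub_le hη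
    refine ⟨C + C + Cσ + κ, fun g => ?_⟩
    obtain ⟨i, hi, hi'⟩ := hfar (ofGroup Γ (f * g)⁻¹) (ofGroup Γ g⁻¹)
    have e1 := abs_le.1 (hC _ (f * g) hi)
    have e2 := abs_le.1 (hC _ g hi')
    have e3 := abs_le.1 (hCσ ((g : M ≃ₜ M) (p i)))
    have e4 := abs_le.1 (hσ.coarseCocycle f g (p i))
    refine abs_le.2 ⟨?_, ?_⟩ <;> linarith

/-- The cocycle at a point away from the limit of the inverses tends to infinity. -/
theorem IsMagnitude.tendsto_cocycle (hN : IsMagnitude Γ σ N) (htop : Tendsto N cofinite atTop)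
    {g : ℕ → Γ} (hg : Function.Injective g) {b : M} {y : GroupUnion Γ}
    (hy : Tendsto (fun n => ofGroup Γ (g n)⁻¹) atTop (𝓝 y)) (hb : ofPoint Γ b ≠ y) :
    Tendsto (fun n => σ (g n) b) atTop atTop := by
  have hpos : 0 < dist (ofPoint Γ b) y := dist_pos.2 hb
  obtain ⟨C, hC⟩ := hN.exists_abs_sub_le (half_pos hpos)
  have hNg : Tendsto (fun n => N (g n) - C) atTop atTop :=
    tendsto_atTop_add_const_right _ _
      (htop.comp (Nat.cofinite_eq_atTop ▸ hg.tendsto_cofinite))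
  refine tendsto_atTop_mono' _ ?_ hNg
  filter_upwards [(tendsto_const_nhds.dist hy).eventually_const_lt (half_lt_self hpos)] with n hn
  linarith [(abs_le.1 (hC b (g n) hn.le)).1]

/-! ### Exclusion of global fixed points. -/

section Fixed

variable {b : M}

/-- If `b` is a global fixed point, then `b` is the limit of every diverging sequence or of its
inverse. -/
theorem IsMagnitude.eq_or_eq_of_fixed (hσ : IsKappaCoarseCocycle Γ κ σ) (hN : IsMagnitude Γ σ N)
    (htop : Tendsto N cofinite atTop) (hb : ∀ γ : Γ, (γ : M ≃ₜ M) b = b) {g : ℕ → Γ}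
    (hg : Function.Injective g) {x y : M}
    (hx : Tendsto (fun n => ofGroup Γ (g n)) atTop (𝓝 (ofPoint Γ x)))
    (hy : Tendsto (fun n => ofGroup Γ (g n)⁻¹) atTop (𝓝 (ofPoint Γ y))) : x = b ∨ y = b := by
  by_contra! hne
  -- Otherwise the cocycle at b would tend to infinity along g n and along the inverses, while the
  -- sum of the two values stays bounded.
  have h1 := hN.tendsto_cocycle htop hg hy (ofPoint_injective.ne hne.2.symm)
  have h2 := hN.tendsto_cocycle htop (g := fun n => (g n)⁻¹) (inv_injective.comp hg)
    (by simpa using hx) (ofPoint_injective.ne hne.1.symm)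
  obtain ⟨n, hn⟩ := ((h1.atTop_add_atTop h2).eventually_gt_atTop (σ 1 b + κ)).exists
  have h3 := abs_le.1 (hσ.coarseCocycle (g n) (g n)⁻¹ b)
  rw [hb, mul_inv_cancel] at h3
  linarith

/-- The conjugates γₙ g γₙ⁻¹ send γₙ to γₙ g, and both sequences tend to p. The cocycle at b is
bounded above on the conjugates and their inverses, so distinct ones could only accumulate at b and
would push γₙ towards b ≠ p. A recurring conjugate fixes p by continuity, that is, g fixes γₙ⁻¹ p.
-/
theorem IsMagnitude.eventually_fixes (hd : IsCompatibleMetric Γ)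
    (hσ : IsKappaCoarseCocycle Γ κ σ) (hN : IsMagnitude Γ σ N)
    (htop : Tendsto N cofinite atTop) (hb : ∀ γ : Γ, (γ : M ≃ₜ M) b = b) {γ : ℕ → Γ}
    (hγ : Function.Injective γ) {p : M} (hpb : p ≠ b)
    (hx : Tendsto (fun n => ofGroup Γ (γ n)) atTop (𝓝 (ofPoint Γ p)))
    (hy : Tendsto (fun n => ofGroup Γ (γ n)⁻¹) atTop (𝓝 (ofPoint Γ b))) (g : Γ) :
    ∀ᶠ n in atTop, g • (γ n)⁻¹ • ofPoint Γ p = (γ n)⁻¹ • ofPoint Γ p := by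
  by_contra hfreq
  rw [Filter.not_eventually] at hfreq
  obtain ⟨φ, hφ, hne⟩ := extraction_of_frequently_atTop hfreq
  replace hγ := hγ.comp hφ.injective
  replace hx := hx.comp hφ.tendsto_atTop
  replace hy := hy.comp hφ.tendsto_atTop
  set c : ℕ → Γ := γ ∘ φ with hc
  have hlim : Tendsto (fun n => ofGroup Γ (c n * g)) atTop (𝓝 (ofPoint Γ p)) :=
    hd.tendsto_smul hγ hx hy (tendsto_const_nhds (x := ofGroup Γ g)) (ofGroup_ne_ofPoint g b)
  have hconj : ∀ n, (c n * g * (c n)⁻¹) • ofGroup Γ (c n) = ofGroup Γ (c n * g) := fun n => by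
    rw [smul_ofGroup, inv_mul_cancel_right]
  have hne' : ∀ n, (c n * g * (c n)⁻¹) • ofPoint Γ p ≠ ofPoint Γ p := by
    intro n h
    refine hne n ?_
    rw [mul_smul, mul_smul, smul_eq_iff_eq_inv_smul] at h
    exact h
  rcases exists_injective_or_const_subseq fun n => c n * g * (c n)⁻¹ with
    ⟨ψ, hψ, hinj⟩ | ⟨ζ, ψ, hψ, hζ⟩
  · obtain ⟨x, y, χ, hχ, hx', hy', -⟩ := hd.exists_subseq hinj
    replace hinj := hinj.comp hχ.injective
    obtain ⟨C, hC⟩ := hσ.exists_conj_le hb g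
    obtain ⟨C', hC'⟩ := hσ.exists_conj_le hb g⁻¹
    have hyb : y = b := by
      by_contra h
      have := hN.tendsto_cocycle htop hinj hy' (ofPoint_injective.ne (Ne.symm h))
      obtain ⟨n, hn⟩ := (this.eventually_gt_atTop C).exists
      exact absurd (hC _) (not_le.2 hn)
    have hxb : x = b := by
      by_contra h
      have := hN.tendsto_cocycle htop (g := fun n => ((fun n => c n * g * (c n)⁻¹) (ψ (χ n)))⁻¹)
        (inv_injective.comp hinj) (by simpa using hx') (ofPoint_injective.ne (Ne.symm h))
      obtain ⟨n, hn⟩ := (this.eventually_gt_atTop C').exists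
      refine absurd (hC' (c (ψ (χ n)))) (not_le.2 ?_)
      simpa [mul_assoc] using hn
    have h1 := hd.tendsto_smul hinj hx' hy' (hx.comp (hψ.comp hχ).tendsto_atTop)
      (hyb ▸ ofPoint_injective.ne hpb)
    have h2 := hlim.comp (hψ.comp hχ).tendsto_atTop
    have h3 : ofPoint Γ x = ofPoint Γ p :=
      tendsto_nhds_unique h1 (h2.congr fun n => (hconj _).symm)
    exact hpb ((ofPoint_injective h3).symm.trans hxb)
  · have h1 := ((hd.continuous_smul ζ).tendsto (ofPoint Γ p)).comp (hx.comp hψ.tendsto_atTop)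
    have h2 := hlim.comp hψ.tendsto_atTop
    refine hne' (ψ 0) ?_
    rw [hζ 0]
    refine tendsto_nhds_unique h1 (h2.congr fun n => ?_)
    change ofGroup Γ (c (ψ n) * g) = ζ • ofGroup Γ (c (ψ n))
    rw [← hconj, hζ n]

/-- If a non-elementary group had a global fixed point, then it would have another one. -/
theorem IsMagnitude.exists_fixed_ne (hd : IsCompatibleMetric Γ)
    (hσ : IsKappaCoarseCocycle Γ κ σ) (hN : IsMagnitude Γ σ N)
    (htop : Tendsto N cofinite atTop) (hb : ∀ γ : Γ, (γ : M ≃ₜ M) b = b) {γ : ℕ → Γ}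
    (hγ : Function.Injective γ) {p : M} (hpb : p ≠ b)
    (hx : Tendsto (fun n => ofGroup Γ (γ n)) atTop (𝓝 (ofPoint Γ p)))
    (hy : Tendsto (fun n => ofGroup Γ (γ n)⁻¹) atTop (𝓝 (ofPoint Γ b))) :
    ∃ q : M, q ≠ b ∧ ∀ γ : Γ, (γ : M ≃ₜ M) q = q := by
  have hfix := hN.eventually_fixes hd hσ htop hb hγ hpb hx hy
  have hbig := hN.tendsto_cocycle htop (g := fun n => (γ n)⁻¹) (inv_injective.comp hγ)
    (by simpa using hx) (ofPoint_injective.ne hpb.symm)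
  -- Above κ the cocycle at b strictly increases along the powers of g. So g has infinite order, and
  -- its fixed points are among the two limits of its powers and their inverses.
  obtain ⟨k, hk⟩ := (hbig.eventually_gt_atTop κ).exists
  set g := (γ k)⁻¹ with hg
  have hmono : StrictMono fun j : ℕ => σ (g ^ j) b := by
    refine strictMono_nat_of_lt_succ fun j => ?_
    have := abs_le.1 (hσ.coarseCocycle (g ^ j) g b)
    rw [hb, ← pow_succ] at this
    linarith
  have hinj : Function.Injective fun j : ℕ => g ^ j := fun i j hij =>
    hmono.injective (congrArg (fun h => σ h b) hij)
  obtain ⟨x, y, φ, hφ, hx', hy', -⟩ := hd.exists_subseq hinj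
  have hfixed : ∀ z : M, (g : M ≃ₜ M) z = z → z = y ∨ z = x := by
    intro z hz
    refine or_iff_not_imp_left.2 fun hzy => ?_
    have hpow : ∀ j : ℕ, g ^ j • ofPoint Γ z = ofPoint Γ z := by
      intro j
      induction j with
      | zero => simp
      | succ j ih => rw [pow_succ, mul_smul, smul_ofPoint, hz, ih]
    have h1 := hd.tendsto_smul (hinj.comp hφ.injective) hx' hy'
      (tendsto_const_nhds (x := ofPoint Γ z)) (ofPoint_injective.ne hzy)
    refine ofPoint_injective (tendsto_nhds_unique (tendsto_const_nhds.congr fun n => ?_) h1)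
    exact (hpow _).symm
  set q : ℕ → M := fun n => (((γ n)⁻¹ : Γ) : M ≃ₜ M) p with hq
  have hfix' : ∀ g : Γ, ∀ᶠ n in atTop, (g : M ≃ₜ M) (q n) = q n := fun g =>
    (hfix g).mono fun n hn => ofPoint_injective hn
  have hqb : ∀ n, q n ≠ b := fun n h =>
    hpb ((((γ n)⁻¹ : Γ) : M ≃ₜ M).injective (h.trans (hb _).symm))
  -- Besides b, the element g has at most one fixed point, and q n ≠ b is eventually fixed by g.
  obtain ⟨c, hc⟩ : ∃ c, ∀ᶠ n in atTop, q n = c := by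
    rcases hfixed b (hb g) with h | h
    · exact ⟨x, (hfix' g).mono fun n hn =>
        (hfixed _ hn).resolve_left fun h' => hqb n (h'.trans h.symm)⟩
    · exact ⟨y, (hfix' g).mono fun n hn =>
        (hfixed _ hn).resolve_right fun h' => hqb n (h'.trans h.symm)⟩
  obtain ⟨n, hn⟩ := hc.exists
  refine ⟨c, hn ▸ hqb n, fun h => ?_⟩
  obtain ⟨n, h1, h2⟩ := ((hfix' h).and hc).exists
  rwa [h2] at h1

end Fixed

/-- A non-elementary group with an expanding cocycle contracts, without global fixed points. -/
theorem IsMagnitude.isContracting (hd : IsCompatibleMetric Γ) (hne : IsNonelementary Γ)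
    (hσ : IsKappaCoarseCocycle Γ κ σ) (hN : IsMagnitude Γ σ N)
    (htop : Tendsto N cofinite atTop) : IsContracting (ofGroup Γ) where
  continuous_smul := hd.continuous_smul
  map_mul _ _ := rfl
  contracting ε hε η hη := hd.contracting hε hη
  exists_smul_ne x := by
    have hM : ∀ u v : M, ∃ z, z ≠ u ∧ z ≠ v := fun u v => by
      obtain ⟨z, -, hz⟩ := hne.exists_mem_ne u v
      exact ⟨z, hz⟩
    have hseq : ∀ u v : M, ∃ p, p ≠ u ∧ p ≠ v ∧ ∃ (g : ℕ → Γ) (y : M), Function.Injective g ∧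
        Tendsto (fun n => ofGroup Γ (g n)) atTop (𝓝 (ofPoint Γ p)) ∧
        Tendsto (fun n => ofGroup Γ (g n)⁻¹) atTop (𝓝 (ofPoint Γ y)) := fun u v => by
      obtain ⟨p, hp, hpu, hpv⟩ := hne.exists_mem_ne u v
      exact ⟨p, hpu, hpv, hd.exists_seq_of_mem_limitSet hM hp⟩
    rcases exists_eq x with ⟨g, rfl⟩ | ⟨b, rfl⟩
    · by_contra! hc
      have h1 : ∀ f : Γ, f = 1 := fun f => by
        have := ofGroup_injective (hc f)
        exact mul_eq_right.1 this
      obtain ⟨z, -⟩ := hne.exists_injective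
      obtain ⟨-, -, -, f, -, hf, -⟩ := hseq (z 0) (z 0)
      exact absurd (hf ((h1 (f 0)).trans (h1 (f 1)).symm)) (by decide)
    · by_contra! hc
      have hb : ∀ γ : Γ, (γ : M ≃ₜ M) b = b := fun γ => ofPoint_injective (hc γ)
      obtain ⟨p, hpb, -, g, y, hg, hx, hy⟩ := hseq b b
      obtain rfl : y = b := (hN.eq_or_eq_of_fixed hσ htop hb hg hx hy).resolve_left hpb
      obtain ⟨q, hqb, hq⟩ := hN.exists_fixed_ne hd hσ htop hb hg hpb hx hy
      -- For a third limit point p', the inverses of a sequence tending to p' would have to tend to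
      -- both fixed points.
      obtain ⟨p', hpb', hpq', g', y', hg', hx', hy'⟩ := hseq y q
      have e1 := (hN.eq_or_eq_of_fixed hσ htop hb hg' hx' hy').resolve_left hpb'
      have e2 := (hN.eq_or_eq_of_fixed hσ htop hq hg' hx' hy').resolve_left hpq'
      exact hqb (e2.symm.trans e1)

end Cocycle

/-! ### Poincaré series and critical exponents. -/

section Exponent

variable {G : Type*} {N N' : G → ℝ}

theorem tendsto_atTop_of_poincareSeries_ne_top {s : ℝ} (hs : 0 < s)
    (h : poincareSeries N s ≠ ∞) : Tendsto N cofinite atTop := by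
  have h1 := ENNReal.tendsto_cofinite_zero_of_tsum_ne_top h
  refine tendsto_atTop.2 fun K => ?_
  have hpos : 0 < ENNReal.ofReal (Real.exp (-s * K)) := by simp [Real.exp_pos]
  filter_upwards [h1.eventually_lt_const hpos] with g hg
  rw [ENNReal.ofReal_lt_ofReal_iff (Real.exp_pos _), Real.exp_lt_exp] at hg
  nlinarith

theorem poincareSeries_le_of_le {s C : ℝ} (hs : 0 ≤ s) (h : ∀ g, N' g ≤ N g + C) :
    poincareSeries N s ≤ expENN (s * C) * poincareSeries N' s := by
  rw [poincareSeries_eq, poincareSeries_eq, ← ENNReal.tsum_mul_left]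
  refine ENNReal.tsum_le_tsum fun g => expENN_le_mul ?_
  nlinarith [h g]

theorem poincareSeries_ne_top_of_abs_sub_le {C : ℝ} (h : ∀ g, |N g - N' g| ≤ C) {s : ℝ}
    (hs : 0 ≤ s) (hN : poincareSeries N s ≠ ∞) : poincareSeries N' s ≠ ∞ :=
  ne_top_of_le_ne_top (ENNReal.mul_ne_top (expENN_ne_top _) hN)
    (poincareSeries_le_of_le (C := C) hs fun g => by linarith [(abs_le.1 (h g)).2])

theorem criticalExponent_le_of_abs_sub_le {C : ℝ} (h : ∀ g, |N g - N' g| ≤ C) :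
    criticalExponent N' ≤ criticalExponent N := by
  refine sInf_le_sInf ?_
  rintro t ⟨s, hs, hfin, rfl⟩
  exact ⟨s, hs, (poincareSeries_ne_top_of_abs_sub_le h hs.le hfin.ne).lt_top, rfl⟩

/-- N may take negative values, so the series is monotone in s only up to a factor, supplied by a
lower bound for N. -/
theorem poincareSeries_ne_top_of_lt {s : ℝ} (hs : criticalExponent N < ENNReal.ofReal s) :
    poincareSeries N s ≠ ∞ := by
  obtain ⟨-, ⟨s', hs', hfin, rfl⟩, hlt⟩ := sInf_lt_iff.1 hs
  have hs's : s' < s := (ENNReal.ofReal_lt_ofReal_iff_of_nonneg hs'.le).1 hlt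
  have htop := tendsto_atTop_of_poincareSeries_ne_top hs' hfin.ne
  obtain ⟨K, hK⟩ := exists_forall_neg_le_of_tendsto htop
  refine ne_top_of_le_ne_top (ENNReal.mul_ne_top (expENN_ne_top ((s - s') * K)) hfin.ne) ?_
  rw [poincareSeries_eq, poincareSeries_eq, ← ENNReal.tsum_mul_left]
  refine ENNReal.tsum_le_tsum fun g => expENN_le_mul ?_
  nlinarith [hK g]

theorem criticalExponent_le_one (h : ∀ s, 1 < s → poincareSeries N s ≠ ∞) :
    criticalExponent N ≤ 1 := by
  refine le_of_forall_gt_imp_ge_of_dense fun t ht => ?_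
  rcases eq_or_ne t ∞ with rfl | htop
  · exact le_top
  · have h1 : 1 < t.toReal := by
      rw [← ENNReal.toReal_one]
      exact (ENNReal.toReal_lt_toReal ENNReal.one_ne_top htop).2 ht
    exact sInf_le ⟨t.toReal, by linarith, (h _ h1).lt_top, (ENNReal.ofReal_toReal htop).symm⟩

end Exponent

end CoarsePS

/-! ### Assembly of the theorem. -/

theorem theorem1p6 {M : Type*} [TopologicalSpace M] [CompactSpace M]
    [TopologicalSpace.MetrizableSpace M]
    (Γ : Subgroup (M ≃ₜ M)) (hΓ : IsConvergenceGroup Γ) (hne : IsNonelementary Γ)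
    [MetricSpace (GroupUnion Γ)] (hd : IsCompatibleMetric Γ)
    (σ₀ σ₁ : Γ → M → ℝ) (hσ₀ : IsExpanding Γ σ₀) (hσ₁ : IsExpanding Γ σ₁)
    (N₀ N₁ : Γ → ℝ) (hN₀ : IsMagnitude Γ σ₀ N₀) (hN₁ : IsMagnitude Γ σ₁ N₁)
    (hδ₀ : criticalExponent N₀ = 1) (hδ₁ : criticalExponent N₁ = 1)
    (lam : ℝ) (hlam₀ : 0 < lam) (hlam₁ : lam < 1) :
    IsExpanding Γ (fun γ x => lam * σ₀ γ x + (1 - lam) * σ₁ γ x) ∧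
    ∀ N : Γ → ℝ, IsMagnitude Γ (fun γ x => lam * σ₀ γ x + (1 - lam) * σ₁ γ x) N →
      criticalExponent N ≤ 1 ∧
      (poincareSeries N (criticalExponent N).toReal = ∞ →
        (criticalExponent N = 1 ↔ BddAbove (Set.range fun γ : Γ => |N₀ γ - N₁ γ|))) := by
  refine ⟨hσ₀.convexComb hσ₁ hlam₀ hlam₁, fun N hN => ?_⟩
  have hQ : ∀ N : Γ → ℝ, criticalExponent N = 1 → ∀ s, 1 < s → poincareSeries N s ≠ ∞ :=
    fun N hδ s hs => poincareSeries_ne_top_of_lt (by simpa [hδ] using hs)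
  have hQ₀ := hQ N₀ hδ₀
  have hQ₁ := hQ N₁ hδ₁
  obtain ⟨κ₀, hκ₀⟩ := hσ₀.isCoarseCocycle
  obtain ⟨κ₁, hκ₁⟩ := hσ₁.isCoarseCocycle
  have htop₀ := tendsto_atTop_of_poincareSeries_ne_top two_pos (hQ₀ 2 one_lt_two)
  have htop₁ := tendsto_atTop_of_poincareSeries_ne_top two_pos (hQ₁ 2 one_lt_two)
  obtain ⟨p, hp⟩ := hne.exists_injective
  obtain ⟨C, hC⟩ := (hN₀.convexComb hN₁ hlam₀.le hlam₁.le).exists_abs_sub_le_of_isMagnitude hp hN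
  have hδ : criticalExponent N ≤ 1 := criticalExponent_le_one fun s hs =>
    poincareSeries_ne_top_of_abs_sub_le hC (by linarith) (ne_top_of_le_ne_top
      (ENNReal.add_ne_top.2 ⟨hQ₀ s hs, hQ₁ s hs⟩)
      (poincareSeries_convexComb_le N₀ N₁ hlam₀.le hlam₁.le s))
  refine ⟨hδ, fun hdiv => ⟨fun h1 => ?_, ?_⟩⟩
  · have hdiv' : poincareSeries (fun γ => lam * N₀ γ + (1 - lam) * N₁ γ) 1 = ∞ := by
      by_contra hfin
      rw [h1, ENNReal.toReal_one] at hdiv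
      exact poincareSeries_ne_top_of_abs_sub_le hC zero_le_one hfin hdiv
    have := hd.compact
    obtain ⟨K, hK⟩ := (hN₀.isContracting hd hne hκ₀ htop₀).exists_abs_sub_le
      (hN₀.isCoarselyAdditive hd hκ₀ hp htop₀) (hN₁.isCoarselyAdditive hd hκ₁ hp htop₁)
      hQ₀ hQ₁ hlam₀ hlam₁ hdiv'
    exact ⟨K, by rintro _ ⟨γ, rfl⟩; exact hK γ⟩
  · rintro ⟨K, hK⟩
    have hK : ∀ γ, |N₀ γ - N₁ γ| ≤ K := fun γ => hK ⟨γ, rfl⟩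
    refine le_antisymm hδ ?_
    rw [← hδ₀]
    -- λN₀ + (1-λ)N₁ differs from N₀ by (1-λ)(N₁ - N₀), hence by at most K, and from N by at most C.
    refine criticalExponent_le_of_abs_sub_le (C := C + K) fun γ => ?_
    have e1 := abs_le.1 (hC γ)
    have e2 := abs_le.1 (hK γ)
    refine abs_le.2 ⟨?_, ?_⟩ <;> nlinarith
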